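/- Theorem 2.1. Let $\lambda$ be an uncountable cardinal which is not the successor of a regular cardinal. Let $\mathrm{reg}(\lambda)$ denote the set of all infinite regular cardinals below $\lambda$; let $\mathsf{CH}_\lambda$ assert that $2^\lambda=\lambda^+$; and for a set of ordinals $A$ let $\mathrm{acc}(A):=\{\beta\in A\mid \beta\neq 0,\ \sup(A\cap\beta)=\beta\}$. A club in an ordinal $\delta$ is a closed cofinal subset of $\delta$. A $\square_\lambda$-sequence is a sequence $\langle C_\alpha\mid\alpha<\lambda^+\rangle$ such that for every nonzero limit ordinal $\alpha<\lambda^+$: $C_\alpha$ is a club in $\alpha$ of order type at most $\lambda$, and $C_\beta=C_\alpha\cap\beta$ for every $\beta\in\mathrm{acc}(C_\alpha)$. The principle $\square_\lambda$ asserts that such a sequence exists. If $\square_\lambda$ and $\mathsf{CH}_\lambda$ hold, then there is a cofinal subset $\Gamma$ of $\mathrm{reg}(\lambda)$ for which there exist a $\square_\lambda$-sequence $\langle C_\alpha\mid\alpha<\lambda^+\rangle$ and a sequence of sets $\langle S_\alpha\mid\alpha<\lambda^+\rangle$ such that: 1. for every nonzero limit ordinal $\alpha<\lambda^+$ and every $\beta\in\mathrm{acc}(C_\alpha)$,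 $S_\beta=S_\alpha\cap\beta$; 2. for every club $D$ in $\lambda^+$, every subset $A\subseteq\lambda^+$ and every $\theta\in\Gamma$, there is some $\alpha<\lambda^+$ such that (a) $C_\alpha\subseteq D$; (b) $S_\alpha=A\cap\alpha$; (c) $\mathrm{cf}(\alpha)=\theta$; (d) $\sup(\mathrm{acc}(C_\alpha))=\alpha$. -/

import Mathlib

open scoped Ordinal Cardinal

universe u

namespace OstSquare

/-- `C` is a club in the ordinal `δ`: a subset of `δ = {α | α < δ}` that is closed and cofinal
in `δ`. -/
def IsClubIn (C : Set Ordinal.{u}) (δ : Ordinal.{u}) : Prop :=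
  C ⊆ Set.Iio δ ∧ IsClub ((fun x : Set.Iio δ => (x : Ordinal.{u})) ⁻¹' C)

/-- `acc A`, the set of accumulation points of `A` that belong to `A`: those nonzero `β ∈ A` with
`sup (A ∩ β) = β`. (The ordinal `0`, for which `sup (A ∩ 0) = 0` holds trivially, is not regarded
as an accumulation point.) -/
def acc (A : Set Ordinal.{u}) : Set Ordinal.{u} :=
  {β | β ∈ A ∧ β ≠ 0 ∧ IsLUB (A ∩ Set.Iio β) β}

/-- `C` is a `□_κ`-sequence. It is given as a function on all ordinals; only its values at the
nonzero limit ordinals below `κ⁺` matter. The order type of a set of ordinals lives one universe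
up, hence the `lift`. -/
structure IsSquareSeq (κ : Cardinal.{u}) (C : Ordinal.{u} → Set Ordinal.{u}) : Prop where
  club : ∀ α < (Order.succ κ).ord, Order.IsSuccLimit α → IsClubIn (C α) α
  otp_le : ∀ α < (Order.succ κ).ord, Order.IsSuccLimit α →
    typeLT (C α) ≤ Ordinal.lift.{u + 1} κ.ord
  coherent : ∀ α < (Order.succ κ).ord, Order.IsSuccLimit α →
    ∀ β ∈ acc (C α), C β = C α ∩ Set.Iio β

/-- Jensen's principle `□_κ`. -/
def Square (κ : Cardinal.{u}) : Prop :=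
  ∃ C : Ordinal.{u} → Set Ordinal.{u}, IsSquareSeq κ C

/-- The local continuum hypothesis `CH_κ`: `2 ^ κ = κ⁺`. -/
def LocalCH (κ : Cardinal.{u}) : Prop :=
  (2 : Cardinal.{u}) ^ κ = Order.succ κ

/-- `reg(κ)`, the set of infinite regular cardinals below `κ`, as a set of ordinals. -/
def reg (κ : Cardinal.{u}) : Set Ordinal.{u} :=
  {θ | θ < κ.ord ∧ θ.cof.ord = θ ∧ ω ≤ θ}

/-- `(C, S)` is a witness to the square with built-in diamond for `κ`, guessing at
cofinalities in `Γ`. -/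
structure IsSquareDiamondSeq (κ : Cardinal.{u}) (Γ : Set Ordinal.{u})
    (C S : Ordinal.{u} → Set Ordinal.{u}) : Prop where
  square : IsSquareSeq κ C
  coherent : ∀ α < (Order.succ κ).ord, Order.IsSuccLimit α →
    ∀ β ∈ acc (C α), S β = S α ∩ Set.Iio β
  guess : ∀ D : Set Ordinal.{u}, IsClubIn D (Order.succ κ).ord →
    ∀ A : Set Ordinal.{u}, A ⊆ Set.Iio (Order.succ κ).ord →
    ∀ θ ∈ Γ, Order.IsSuccLimit θ →
    ∃ α < (Order.succ κ).ord,
      C α ⊆ D ∧ S α = A ∩ Set.Iio α ∧ α.cof.ord = θ ∧ IsLUB (acc (C α)) α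

/-- The square with built-in diamond for `κ`, guessing at cofinalities in `Γ`. -/
def SquareDiamond (κ : Cardinal.{u}) (Γ : Set Ordinal.{u}) : Prop :=
  ∃ C S : Ordinal.{u} → Set Ordinal.{u}, IsSquareDiamondSeq κ Γ C S

end OstSquare

/-! Fix a square sequence `C` and let the rank of `α` be the order type of `C α`, at most `κ`. If `θ
< κ` is regular, uncountable and different from the cofinality of `κ`, points of cofinality `θ` have
rank below `κ`, so stationarily many of them share one rank `ξ θ`. On this stationary set `G` the
clubs `C α` have a common size `ρ < κ`.

Guessing on one such `G` takes two steps. Dropping the points of `C α` to a suitable club `D` makes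
the sequence guess clubs (`exists_dropSeq_guess`): otherwise iterating the counterexamples gives a
decreasing sequence of clubs, longer than `ρ`, along which some drop must stabilise. By `CH_κ`,
subsets of `a < κ⁺` can be guessed at consecutive pairs `(a, b)` of `C α`, and `C α` thinned to the
pairs where a guess is made. `exists_thin_guess` diagonalises over `κ × κ` many ways of guessing to
find one that succeeds.

The sequences for different ranks are then glued: `glue` uses, between two chosen ranks, the
sequence attached to the upper one. A point of rank `ξ θ` keeps its guess as long as `ξ θ` is not a
limit of the chosen ranks, and `isCofinalFor_isolatedReg` shows that cofinally many `θ` have this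
property. -/

namespace OstSquare

open Set Order Ordinal Cardinal

/-! ### Limit points, clubs and stationary sets. -/

/-- `δ` is a nonzero limit of elements of `A`. -/
def IsLimitPt (A : Set Ordinal.{u}) (δ : Ordinal.{u}) : Prop :=
  δ ≠ 0 ∧ ∀ γ < δ, ∃ β ∈ A, γ < β ∧ β < δ

/-- `c` is a closed unbounded subset of the limit ordinal `δ`. -/
structure Club (c : Set Ordinal.{u}) (δ : Ordinal.{u}) : Prop where
  lt : ∀ β ∈ c, β < δ
  unbdd : ∀ γ < δ, ∃ β ∈ c, γ < β
  closed : ∀ ε < δ, IsLimitPt c ε → ε ∈ c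

theorem isLimitPt_iff {A : Set Ordinal.{u}} {δ : Ordinal.{u}} :
    IsLimitPt A δ ↔ δ ≠ 0 ∧ IsLUB (A ∩ Iio δ) δ := by
  refine and_congr_right fun _ => ⟨fun h => ⟨fun x hx => hx.2.le, fun b hb => ?_⟩, fun h γ hγ => ?_⟩
  · by_contra! hlt
    obtain ⟨β, hβ, h1, h2⟩ := h b hlt
    exact (hb ⟨hβ, h2⟩).not_gt h1
  · by_contra! hno
    refine hγ.not_ge (h.2 fun x hx => ?_)
    by_contra! hx'
    exact (hno x hx.1 hx').not_gt hx.2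

theorem mem_acc_iff {A : Set Ordinal.{u}} {β : Ordinal.{u}} : β ∈ acc A ↔ β ∈ A ∧ IsLimitPt A β := by
  rw [isLimitPt_iff]; rfl

theorem IsLimitPt.isSuccLimit {A : Set Ordinal.{u}} {δ : Ordinal.{u}} (h : IsLimitPt A δ) :
    IsSuccLimit δ := by
  refine Ordinal.isSuccLimit_iff.2 ⟨h.1, fun γ hγ => ?_⟩
  obtain ⟨β, -, h1, h2⟩ := h.2 γ hγ.lt
  exact hγ.2 h1 h2

theorem IsLimitPt.mono {A B : Set Ordinal.{u}} {δ : Ordinal.{u}} (h : IsLimitPt A δ) (hAB : A ⊆ B) :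
    IsLimitPt B δ :=
  ⟨h.1, fun γ hγ => let ⟨β, hβ, h'⟩ := h.2 γ hγ; ⟨β, hAB hβ, h'⟩⟩

/-- Being a limit point of `A` depends only on the elements below. -/
theorem IsLimitPt.of_subset {A B : Set Ordinal.{u}} {δ : Ordinal.{u}} (h : IsLimitPt A δ)
    (hAB : ∀ x ∈ A, x < δ → x ∈ B) : IsLimitPt B δ :=
  ⟨h.1, fun γ hγ => let ⟨β, hβ, h'⟩ := h.2 γ hγ; ⟨β, hAB β hβ h'.2, h'⟩⟩

theorem IsLimitPt.pos {A : Set Ordinal.{u}} {δ : Ordinal.{u}} (h : IsLimitPt A δ) : 0 < δ :=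
  pos_iff_ne_zero.2 h.1

/-- A limit of limit points of `A` is a limit point of `A`. -/
theorem IsLimitPt.trans {A B : Set Ordinal.{u}} {δ : Ordinal.{u}} (h : IsLimitPt B δ)
    (hAB : ∀ x ∈ B, x ∈ A ∨ IsLimitPt A x) : IsLimitPt A δ := by
  refine ⟨h.1, fun γ hγ => ?_⟩
  obtain ⟨β, hβ, h1, h2⟩ := h.2 γ hγ
  rcases hAB β hβ with h' | h'
  · exact ⟨β, h', h1, h2⟩
  · obtain ⟨x, hx, h3, h4⟩ := h'.2 γ h1
    exact ⟨x, hx, h3, h4.trans h2⟩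

theorem isClubIn_iff {c : Set Ordinal.{u}} {δ : Ordinal.{u}} (hδ : IsSuccLimit δ) :
    IsClubIn c δ ↔ Club c δ := by
  constructor
  · rintro ⟨h1, h2⟩
    refine ⟨h1, fun γ hγ => ?_, fun ε hε h => ?_⟩
    · obtain ⟨b, hb, hb'⟩ := h2.isCofinal ⟨succ γ, hδ.succ_lt hγ⟩
      exact ⟨b, hb, (lt_succ γ).trans_le hb'⟩
    · have := h2.isLUB_mem (t := {x : Iio δ | (x : Ordinal) ∈ c ∧ (x : Ordinal) < ε}) (x := (⟨ε, hε⟩ : Iio δ))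
        (fun x hx => hx.1) ?_ ⟨fun x hx => hx.2.le, fun b hb => ?_⟩
      · exact this
      · obtain ⟨β, hβ, -, h'⟩ := h.2 0 h.pos
        exact ⟨⟨β, h'.trans hε⟩, hβ, h'⟩
      · by_contra! hlt
        obtain ⟨β, hβ, h3, h4⟩ := h.2 b hlt
        exact (hb (a := ⟨β, h4.trans hε⟩) ⟨hβ, h4⟩).not_gt h3
  · intro h
    refine ⟨h.lt, fun d hd hne _ a ha => ?_, fun a => ?_⟩
    · by_contra hac
      have hda : ∀ x ∈ d, x < a := fun x hx =>
        lt_of_le_of_ne (ha.1 hx) fun h' => hac (h' ▸ hd hx)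
      refine hac (h.closed a a.2 ⟨?_, fun γ hγ => ?_⟩)
      · obtain ⟨x, hx⟩ := hne
        exact (bot_le.trans_lt (show (x : Ordinal) < a from hda x hx)).ne'
      · by_contra! hno
        have : a ≤ ⟨γ, hγ.trans a.2⟩ := ha.2 fun x hx => by
          by_contra! hx'
          exact (hno x (hd hx) hx').not_gt (hda x hx)
        exact this.not_gt hγ
    · obtain ⟨β, hβ, h'⟩ := h.unbdd a a.2
      exact ⟨⟨β, h.lt β hβ⟩, hβ, h'.le⟩

theorem isSuccLimit_of_uncountable_cof {δ : Ordinal.{u}} (h : ℵ₀ < δ.cof) : IsSuccLimit δ :=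
  one_lt_cof_iff.1 (one_lt_aleph0.trans h)

/-- A function from an ordinal of uncountable cofinality to itself has closure points. -/
theorem exists_closure_point {δ : Ordinal.{u}} (hδ : ℵ₀ < δ.cof) {g : Ordinal.{u} → Ordinal.{u}}
    (hg : ∀ β < δ, g β < δ) (hg' : ∀ β < δ, β < g β) {γ : Ordinal.{u}} (hγ : γ < δ) :
    ∃ ε < δ, γ < ε ∧ ∀ β < ε, ∃ x < ε, β < x ∧ g x < ε := by
  let a : ℕ → Ordinal.{u} := fun n => g^[n] γ
  have ha : ∀ n, a n < δ := fun n => by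
    induction n with
    | zero => exact hγ
    | succ n ih => simpa only [a, Function.iterate_succ_apply'] using hg _ ih
  have ha' : ∀ n, a n < a (n + 1) := fun n => by
    simpa only [a, Function.iterate_succ_apply'] using hg' _ (ha n)
  have hle : ∀ n, a n < ⨆ n, a n := fun n => (ha' n).trans_le (Ordinal.le_iSup a (n + 1))
  refine ⟨⨆ n, a n, ?_, hle 0, fun β hβ => ?_⟩
  · apply lift_iSup_lt_of_lt_cof _ ha
    simpa using hδ
  · obtain ⟨n, hn⟩ := (Ordinal.lt_iSup_iff).1 hβ
    refine ⟨a n, hle n, hn, ?_⟩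
    have := hle (n + 1)
    rwa [show a (n + 1) = g (a n) from Function.iterate_succ_apply' ..] at this

/-- In uncountable cofinality, the accumulation points of a club are cofinal. -/
theorem Club.isLUB_acc {c : Set Ordinal.{u}} {δ : Ordinal.{u}} (h : Club c δ) (hδ : ℵ₀ < δ.cof) :
    IsLUB (acc c) δ := by
  refine ⟨fun x hx => (h.lt x hx.1).le, fun b hb => ?_⟩
  by_contra! hlt
  choose! g hg hg' using h.unbdd
  obtain ⟨ε, hε, h1, h2⟩ := exists_closure_point hδ (fun β hβ => h.lt _ (hg β hβ)) hg' hlt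
  have hl : IsLimitPt c ε := ⟨(bot_le.trans_lt h1).ne', fun γ hγ => by
    obtain ⟨x, hx, h3, h4⟩ := h2 γ hγ
    exact ⟨g x, hg x (hx.trans hε), h3.trans (hg' x (hx.trans hε)), h4⟩⟩
  exact (hb (mem_acc_iff.2 ⟨h.closed ε hε hl, hl⟩)).not_gt h1

/-- A function on a regular uncountable `Λ` has a club of closure points. -/
theorem club_closure_points {Λ : Ordinal.{u}} (hΛ : ℵ₀ < Λ.cof) (hreg : Λ.cof.ord = Λ)
    {g : Ordinal.{u} → Ordinal.{u}} (hg : ∀ β < Λ, g β < Λ) :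
    Club {δ | δ < Λ ∧ ∀ β < δ, g β < δ} Λ := by
  have hlim := isSuccLimit_of_uncountable_cof hΛ
  refine ⟨fun β hβ => hβ.1, fun γ hγ => ?_, fun ε hε h => ⟨hε, fun β hβ => ?_⟩⟩
  · let G : Ordinal.{u} → Ordinal.{u} := fun x => succ (max x (sSup (g '' Iio x)))
    have hbd : ∀ x, BddAbove (g '' Iio x) := fun x => Ordinal.bddAbove_of_small
    have hG : ∀ x < Λ, G x < Λ := fun x hx => by
      refine hlim.succ_lt (max_lt hx (sSup_lt_of_lt_cof (mk_image_le.trans_lt ?_) ?_))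
      · rw [Cardinal.mk_Iio_ordinal, ← Ordinal.lift_cof, Cardinal.lift_lt, ← lt_ord, hreg]
        exact hx
      · rintro _ ⟨y, hy, rfl⟩
        exact hg y (lt_trans hy hx)
    obtain ⟨ε, hε, h1, h2⟩ := exists_closure_point hΛ hG
      (fun x _ => lt_succ_iff.2 (le_max_left ..)) hγ
    refine ⟨ε, ⟨hε, fun β hβ => ?_⟩, h1⟩
    obtain ⟨x, hx, h3, h4⟩ := h2 β hβ
    exact (lt_succ_iff.2 ((le_csSup (hbd x) ⟨β, h3, rfl⟩).trans (le_max_right _ _))).trans h4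
  · obtain ⟨x, hx, h1, h2⟩ := h.2 β hβ
    exact (hx.2 β h1).trans h2

theorem Club.univ {Λ : Ordinal.{u}} (hΛ : IsSuccLimit Λ) : Club (Iio Λ) Λ :=
  ⟨fun _ h => h, fun γ hγ => ⟨succ γ, hΛ.succ_lt hγ, lt_succ γ⟩, fun _ h _ => h⟩

/-- The intersection of fewer than `cof Λ` many clubs is a club. -/
theorem Club.iInter {Λ : Ordinal.{u}} (hΛ : ℵ₀ < Λ.cof) {o : Ordinal.{u}} (ho : o.card < Λ.cof)
    {D : Ordinal.{u} → Set Ordinal.{u}} (hD : ∀ i < o, Club (D i) Λ) :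
    Club {x | x < Λ ∧ ∀ i < o, x ∈ D i} Λ := by
  have hlim := isSuccLimit_of_uncountable_cof hΛ
  refine ⟨fun β hβ => hβ.1, fun γ hγ => ?_, fun ε hε h => ⟨hε, fun i hi => ?_⟩⟩
  · choose! f hf hf' using fun i hi => (hD i hi).unbdd
    let G : Ordinal.{u} → Ordinal.{u} := fun x => succ (max x (sSup ((f · x) '' Iio o)))
    have hbd : ∀ x, BddAbove ((f · x) '' Iio o) := fun x => Ordinal.bddAbove_of_small
    have hG : ∀ x < Λ, G x < Λ := fun x hx => by
      refine hlim.succ_lt (max_lt hx (sSup_lt_of_lt_cof (mk_image_le.trans_lt ?_) ?_))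
      · rw [Cardinal.mk_Iio_ordinal, ← Ordinal.lift_cof, Cardinal.lift_lt]
        exact ho
      · rintro _ ⟨i, hi, rfl⟩
        exact (hD i hi).lt _ (hf i hi x hx)
    obtain ⟨ε, hε, h1, h2⟩ := exists_closure_point hΛ hG
      (fun x _ => lt_succ_iff.2 (le_max_left ..)) hγ
    refine ⟨ε, ⟨hε, fun i hi => (hD i hi).closed ε hε ⟨(bot_le.trans_lt h1).ne', fun β hβ => ?_⟩⟩, h1⟩
    obtain ⟨x, hx, h3, h4⟩ := h2 β hβ
    exact ⟨f i x, hf i hi x (hx.trans hε), h3.trans (hf' i hi x (hx.trans hε)),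
      (lt_succ_iff.2 ((le_csSup (hbd x) ⟨i, hi, rfl⟩).trans (le_max_right _ _))).trans h4⟩
  · exact (hD i hi).closed ε hε (h.mono fun x hx => hx.2 i hi)

theorem Club.inter {Λ : Ordinal.{u}} (hΛ : ℵ₀ < Λ.cof) {D E : Set Ordinal.{u}} (hD : Club D Λ)
    (hE : Club E Λ) : Club (D ∩ E) Λ := by
  have := Club.iInter hΛ (o := 2) (by simpa using (Cardinal.ofNat_lt_aleph0 (n := 2)).trans hΛ)
    (D := fun i => if i = 0 then D else E) (fun i _ => by split_ifs <;> assumption)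
  refine ⟨fun β h => hD.lt β h.1, fun γ hγ => ?_, fun ε hε h =>
    ⟨hD.closed ε hε (h.mono inter_subset_left), hE.closed ε hε (h.mono inter_subset_right)⟩⟩
  obtain ⟨β, ⟨-, h⟩, h'⟩ := this.unbdd γ hγ
  exact ⟨β, ⟨by simpa using h 0 (by simp), by simpa using h 1 (by simp)⟩, h'⟩

/-- The limit points of a club form a club. -/
theorem Club.limitPts {Λ : Ordinal.{u}} (hΛ : ℵ₀ < Λ.cof) {D : Set Ordinal.{u}} (hD : Club D Λ) :
    Club {x | x < Λ ∧ IsLimitPt D x} Λ := by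
  refine ⟨fun β h => h.1, fun γ hγ => ?_, fun ε hε h => ⟨hε, h.trans fun x hx => .inr hx.2⟩⟩
  obtain ⟨x, hx, h⟩ := (lt_isLUB_iff (hD.isLUB_acc hΛ)).1 hγ
  exact ⟨x, ⟨hD.lt x hx.1, (mem_acc_iff.1 hx).2⟩, h⟩

/-- `G` meets every club of `Λ`. -/
def Stationary (G : Set Ordinal.{u}) (Λ : Ordinal.{u}) : Prop :=
  ∀ D, Club D Λ → ∃ α ∈ G, α ∈ D

/-- The ordinals of a fixed regular cofinality below a regular `Λ` form a stationary set. -/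
theorem stationary_cof {Λ θ : Ordinal.{u}} (hreg : Λ.cof.ord = Λ)
    (hθ : θ < Λ) (hθ' : θ.cof.ord = θ) (hω : ω ≤ θ) :
    Stationary {α | α < Λ ∧ α.cof.ord = θ} Λ := by
  intro D hD
  have key : ∀ s : Set Ordinal.{u}, ∃ x, s ⊆ Iio Λ → #s < Cardinal.lift.{u + 1} Λ.cof →
      x ∈ D ∧ ∀ y ∈ s, y < x := fun s => by
    by_cases h : s ⊆ Iio Λ ∧ #s < Cardinal.lift.{u + 1} Λ.cof
    · obtain ⟨x, hx, h'⟩ := hD.unbdd (sSup s) (sSup_lt_of_lt_cof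
        (by rw [← Ordinal.lift_cof]; exact h.2) h.1)
      have : Small.{u} s := by
        rw [Cardinal.small_iff_lift_mk_lt_univ, Cardinal.lift_id]
        exact h.2.trans (Cardinal.lift_lt_univ _)
      exact ⟨x, fun _ _ => ⟨hx, fun y hy =>
        (le_csSup Ordinal.bddAbove_of_small hy).trans_lt h'⟩⟩
    · exact ⟨0, fun h1 h2 => (h ⟨h1, h2⟩).elim⟩
  choose F hF using key
  -- Below `Λ`, `f` increases through `D`; the supremum of its first `θ` values is the required
  -- point.
  let f : Ordinal.{u} → Ordinal.{u} := WellFoundedLT.fix fun i ih => F (range fun j : Iio i => ih j j.2)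
  have hf : ∀ i, f i = F (f '' Iio i) := fun i => by
    rw [image_eq_range]
    exact WellFoundedLT.fix_eq ..
  have hcard : ∀ i < Λ, #(f '' Iio i) < Cardinal.lift.{u + 1} Λ.cof := fun i hi => by
    refine mk_image_le.trans_lt ?_
    rwa [Cardinal.mk_Iio_ordinal, Cardinal.lift_lt, ← lt_ord, hreg]
  have hfD : ∀ i < Λ, f i ∈ D := fun i => by
    induction i using WellFoundedLT.induction with
    | ind i ih =>
      intro hi
      rw [hf]
      refine (hF _ ?_ (hcard i hi)).1
      rintro _ ⟨j, hj, rfl⟩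
      exact hD.lt _ (ih j hj (lt_trans hj hi))
  have hmono : ∀ i < Λ, ∀ j < i, f j < f i := fun i hi j hj => by
    rw [hf i]
    refine (hF _ ?_ (hcard i hi)).2 _ ⟨j, hj, rfl⟩
    rintro _ ⟨k, hk, rfl⟩
    exact hD.lt _ (hfD k (lt_trans hk hi))
  have hθlim : IsSuccLimit θ := one_lt_cof_iff.1
    (one_lt_aleph0.trans_le (by rwa [← ord_le_ord, ord_aleph0, hθ']))
  let f' : Iio θ → Ordinal.{u} := fun i => f i
  have hf' : StrictMono f' := fun i j hij => hmono j (lt_trans j.2 hθ) i hij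
  have hle : ∀ i < θ, f i < ⨆ i, f' i := fun i hi =>
    (hmono (succ i) ((hθlim.succ_lt hi).trans hθ) i (lt_succ i)).trans_le
      (Ordinal.le_iSup f' ⟨succ i, hθlim.succ_lt hi⟩)
  have hlt : ⨆ i, f' i < Λ := lt_of_le_of_lt
    (Ordinal.iSup_le fun i => (hmono θ hθ i i.2).le) (hD.lt _ (hfD θ hθ))
  refine ⟨⨆ i, f' i, ⟨hlt, ?_⟩, hD.closed _ hlt ⟨(bot_le.trans_lt (hle 0 hθlim.bot_lt)).ne', ?_⟩⟩
  · rw [cof_iSup_Iio hf' hθlim.isSuccPrelimit, hθ']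
  · intro γ hγ
    obtain ⟨i, hi⟩ := Ordinal.lt_iSup_iff.1 hγ
    exact ⟨f i, hfD _ (lt_trans i.2 hθ), hi, hle i i.2⟩

/-- A partition of a stationary set into fewer than `cof Λ` pieces has a stationary piece. -/
theorem Stationary.exists_fiber {Λ o : Ordinal.{u}} (hΛ : ℵ₀ < Λ.cof) (ho : o.card < Λ.cof)
    {G : Set Ordinal.{u}} (hG : Stationary G Λ) {f : Ordinal.{u} → Ordinal.{u}}
    (hf : ∀ α ∈ G, f α < o) : ∃ ξ < o, Stationary {α | α ∈ G ∧ f α = ξ} Λ := by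
  by_contra! hno
  have : ∀ ξ, ∃ D, ξ < o → Club D Λ ∧ ∀ α ∈ G, f α = ξ → α ∉ D := fun ξ => by
    by_cases h : ξ < o
    · have := hno ξ h
      simp only [Stationary, not_forall] at this
      obtain ⟨D, hD, h'⟩ := this
      exact ⟨D, fun _ => ⟨hD, fun α h1 h2 h3 => h' ⟨α, ⟨h1, h2⟩, h3⟩⟩⟩
    · exact ⟨∅, fun h' => (h h').elim⟩
  choose D hD using this
  obtain ⟨α, h1, -, h2⟩ := hG _ (Club.iInter hΛ ho fun i hi => (hD i hi).1)
  exact (hD _ (hf α h1)).2 α h1 rfl (h2 _ (hf α h1))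

theorem Stationary.inter {Λ : Ordinal.{u}} (hΛ : ℵ₀ < Λ.cof) {G D : Set Ordinal.{u}}
    (hG : Stationary G Λ) (hD : Club D Λ) : Stationary (G ∩ D) Λ := fun _ hE =>
  let ⟨α, h1, h2, h3⟩ := hG _ (hD.inter hΛ hE)
  ⟨α, ⟨h1, h2⟩, h3⟩

/-- If `cof δ ≠ cof o`, a function from a cofinal subset of `δ` to `o` is bounded on a cofinal
subset. -/
theorem exists_bounded_on_cofinal {δ o : Ordinal.{u}} (ho : IsSuccLimit o)
    (hne : δ.cof ≠ o.cof) {U : Set Ordinal.{u}} (hU : ∀ γ < δ, ∃ β ∈ U, γ < β ∧ β < δ)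
    {h : Ordinal.{u} → Ordinal.{u}} (hh : ∀ β ∈ U, h β < o) :
    ∃ i < o, ∀ γ < δ, ∃ β ∈ U, γ < β ∧ β < δ ∧ h β < i := by
  rcases hne.lt_or_gt with hlt | hlt
  -- If `cof δ < cof o`, choose `cof δ` many points of `U` cofinal in `δ`: their values are bounded
  -- below `o`.
  · obtain ⟨s, hs, hs'⟩ := Order.exists_cof_eq (Iio δ)
    rw [cof_Iio, ← lift_cof] at hs'
    choose! g hg hg1 hg2 using hU
    refine ⟨succ (sSup (range fun x : s => h (g x))), ho.succ_lt (sSup_lt_of_lt_cof ?_ ?_),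
      fun γ hγ => ?_⟩
    · refine mk_range_le.trans_lt ?_
      rwa [hs', ← lift_cof, Cardinal.lift_lt]
    · rintro _ ⟨x, rfl⟩
      exact hh _ (hg _ x.1.2)
    · obtain ⟨x, hx, hx'⟩ := hs ⟨γ, hγ⟩
      have : Small.{u} s := by
        rw [Cardinal.small_iff_lift_mk_lt_univ, Cardinal.lift_id, hs']
        exact Cardinal.lift_lt_univ _
      exact ⟨g x, hg x x.2, lt_of_le_of_lt hx' (hg1 x x.2), hg2 x x.2,
        lt_succ_iff.2 (le_csSup Ordinal.bddAbove_of_small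
          (mem_range_self (f := fun x : s => h (g x)) ⟨x, hx⟩))⟩
  -- If `cof o < cof δ`, take cofinally many `x < o`. The stages from which values below `x` no
  -- longer occur have a supremum below `δ`, and no value is possible beyond it.
  · by_contra! hno
    choose! b hb hb' using hno
    obtain ⟨s, hs, hs'⟩ := Order.exists_cof_eq (Iio o)
    rw [cof_Iio, ← lift_cof] at hs'
    have : Small.{u} s := by
      rw [Cardinal.small_iff_lift_mk_lt_univ, Cardinal.lift_id, hs']
      exact Cardinal.lift_lt_univ _
    have hsup : sSup (range fun x : s => b x) < δ := by
      refine sSup_lt_of_lt_cof (mk_range_le.trans_lt ?_) ?_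
      · rwa [hs', ← lift_cof, Cardinal.lift_lt]
      · rintro _ ⟨x, rfl⟩
        exact hb _ x.1.2
    obtain ⟨β, hβ, h1, h2⟩ := hU _ hsup
    obtain ⟨x, hx, hx'⟩ := hs ⟨succ (h β), ho.succ_lt (hh β hβ)⟩
    refine (hb' x x.2 β hβ ((le_csSup Ordinal.bddAbove_of_small
      (mem_range_self (f := fun x : s => b x) ⟨x, hx⟩)).trans_lt h1)
      h2).not_gt ((lt_succ _).trans_le hx')

/-! ### Coherent sequences and dropping to a club. -/

/-- A coherent sequence of clubs of length `Λ`. -/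
structure CoherentClubs (Λ : Ordinal.{u}) (C : Ordinal.{u} → Set Ordinal.{u}) : Prop where
  club : ∀ α < Λ, IsSuccLimit α → Club (C α) α
  coh : ∀ α < Λ, IsSuccLimit α → ∀ β < α, IsLimitPt (C α) β → C β = C α ∩ Iio β

/-- `S` coheres along the accumulation points of the sets `C α`. -/
def CoherentSets (Λ : Ordinal.{u}) (C S : Ordinal.{u} → Set Ordinal.{u}) : Prop :=
  ∀ α < Λ, IsSuccLimit α → ∀ β < α, IsLimitPt (C α) β → S β = S α ∩ Iio β

/-- The sequence obtained from `C` by moving each point down to the club `D`. -/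
noncomputable def dropSeq (C : Ordinal.{u} → Set Ordinal.{u}) (D : Set Ordinal.{u})
    (α : Ordinal.{u}) : Set Ordinal.{u} :=
  open Classical in
  if IsLimitPt D α then {m | ∃ β ∈ C α, IsGreatest (D ∩ Iic β) m}
  else {β | β ∈ C α ∧ ∀ d ∈ D, d < α → d < β}

theorem Club.exists_isGreatest {D : Set Ordinal.{u}} {Λ β : Ordinal.{u}} (hD : Club D Λ)
    (hβ : β < Λ) (hne : (D ∩ Iic β).Nonempty) : ∃ m, IsGreatest (D ∩ Iic β) m := by
  have hlub := isLUB_csSup hne (bddAbove_Iic.mono inter_subset_right)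
  have hle : sSup (D ∩ Iic β) ≤ β := hlub.2 fun x hx => hx.2
  refine ⟨sSup (D ∩ Iic β), ⟨?_, hle⟩, hlub.1⟩
  by_contra hnot
  refine hnot (hD.closed _ (hle.trans_lt hβ) ⟨fun h0 => ?_, fun γ hγ => ?_⟩)
  · obtain ⟨x, hx⟩ := hne
    have := hlub.1 hx
    rw [h0, nonpos_iff_eq_zero] at this
    exact hnot (h0 ▸ this ▸ hx.1)
  · obtain ⟨x, hx, h'⟩ := (lt_isLUB_iff hlub).1 hγ
    exact ⟨x, hx.1, h', (hlub.1 hx).lt_of_ne fun h => hnot (h ▸ hx.1)⟩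

section dropSeq

variable {Λ : Ordinal.{u}} {C : Ordinal.{u} → Set Ordinal.{u}} {D : Set Ordinal.{u}}

theorem mem_dropSeq_of_isLimitPt {α m : Ordinal.{u}} (h : IsLimitPt D α) :
    m ∈ dropSeq C D α ↔ ∃ β ∈ C α, IsGreatest (D ∩ Iic β) m := by
  simp [dropSeq, h]

theorem mem_dropSeq_of_not_isLimitPt {α m : Ordinal.{u}} (h : ¬ IsLimitPt D α) :
    m ∈ dropSeq C D α ↔ m ∈ C α ∧ ∀ d ∈ D, d < α → d < m := by
  simp [dropSeq, h]

/-- Projections to `D` interlace with the points projected: if `m < m'` are the projections of `β`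
and `β'`, then `m ≤ β < m'`. -/
theorem isLimitPt_of_dropSeq {α δ : Ordinal.{u}} (h : IsLimitPt (dropSeq C D α) δ) :
    IsLimitPt (C α) δ := by
  by_cases hα : IsLimitPt D α
  · refine ⟨h.1, fun γ hγ => ?_⟩
    obtain ⟨m, hm, h1, h2⟩ := h.2 γ hγ
    obtain ⟨m', hm', h3, h4⟩ := h.2 m h2
    rw [mem_dropSeq_of_isLimitPt hα] at hm hm'
    obtain ⟨β, hβ, hg⟩ := hm
    obtain ⟨β', hβ', hg'⟩ := hm'
    refine ⟨β, hβ, h1.trans_le hg.1.2, lt_of_lt_of_le ?_ h4.le⟩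
    by_contra! hle
    exact (hg.2 ⟨hg'.1.1, hle⟩).not_gt h3
  · exact h.mono fun x hx => ((mem_dropSeq_of_not_isLimitPt hα).1 hx).1

/-- Coherence needs the same branch of `dropSeq` at `α` and `δ`. In the first branch all new points
lie in `D`; in the second they all lie above `D ∩ α`, so `D` cannot accumulate at `δ`. -/
theorem isLimitPt_dropSeq_iff {α δ : Ordinal.{u}} (h : IsLimitPt (dropSeq C D α) δ) (hδ : δ ≤ α) :
    IsLimitPt D α ↔ IsLimitPt D δ := by
  by_cases hα : IsLimitPt D α
  · refine ⟨fun _ => h.mono fun m hm => ?_, fun _ => hα⟩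
    obtain ⟨β, -, hg⟩ := (mem_dropSeq_of_isLimitPt hα).1 hm
    exact hg.1.1
  · refine ⟨fun h' => (hα h').elim, fun h' => ?_⟩
    obtain ⟨m, hm, -, h2⟩ := h.2 0 h.pos
    obtain ⟨d, hd, h3, h4⟩ := h'.2 m h2
    exact ((((mem_dropSeq_of_not_isLimitPt hα).1 hm).2 d hd (h4.trans_le hδ)).not_gt h3).elim

theorem CoherentClubs.dropSeq (hC : CoherentClubs Λ C) (hD : Club D Λ) :
    CoherentClubs Λ (dropSeq C D) := by
  refine ⟨fun α hαΛ hα => ⟨fun m hm => ?_, fun γ hγ => ?_, fun ε hε h => ?_⟩,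
    fun α hαΛ hα δ hδ h => ?_⟩
  · by_cases hl : IsLimitPt D α
    · obtain ⟨β, hβ, hg⟩ := (mem_dropSeq_of_isLimitPt hl).1 hm
      exact hg.1.2.trans_lt ((hC.club α hαΛ hα).lt β hβ)
    · exact (hC.club α hαΛ hα).lt m ((mem_dropSeq_of_not_isLimitPt hl).1 hm).1
  · by_cases hl : IsLimitPt D α
    · obtain ⟨d, hd, h1, h2⟩ := hl.2 γ hγ
      obtain ⟨β, hβ, h3⟩ := (hC.club α hαΛ hα).unbdd d h2
      obtain ⟨m, hm⟩ := hD.exists_isGreatest (((hC.club α hαΛ hα).lt β hβ).trans hαΛ) ⟨d, hd, h3.le⟩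
      exact ⟨m, (mem_dropSeq_of_isLimitPt hl).2 ⟨β, hβ, hm⟩, h1.trans_le (hm.2 ⟨hd, h3.le⟩)⟩
    · have : ∃ γ' < α, ∀ d ∈ D, d < α → d ≤ γ' := by
        by_contra! hno
        exact hl ⟨hα.bot_lt.ne', fun γ hγ => by
          obtain ⟨d, h1, h2, h3⟩ := hno γ hγ
          exact ⟨d, h1, h3, h2⟩⟩
      obtain ⟨γ', hγ', h'⟩ := this
      obtain ⟨β, hβ, h3⟩ := (hC.club α hαΛ hα).unbdd _ (max_lt hγ hγ')
      exact ⟨β, (mem_dropSeq_of_not_isLimitPt hl).2 ⟨hβ, fun d hd hd' =>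
        (h' d hd hd').trans_lt ((le_max_right _ _).trans_lt h3)⟩, (le_max_left _ _).trans_lt h3⟩
  · have hεC := (hC.club α hαΛ hα).closed ε hε (isLimitPt_of_dropSeq h)
    by_cases hl : IsLimitPt D α
    · exact (mem_dropSeq_of_isLimitPt hl).2 ⟨ε, hεC,
        ⟨hD.closed ε (hε.trans hαΛ) ((isLimitPt_dropSeq_iff h hε.le).1 hl), self_mem_Iic⟩,
        fun x hx => hx.2⟩
    · obtain ⟨m, hm, -, h2⟩ := h.2 0 h.pos
      exact (mem_dropSeq_of_not_isLimitPt hl).2 ⟨hεC, fun d hd hd' =>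
        (((mem_dropSeq_of_not_isLimitPt hl).1 hm).2 d hd hd').trans h2⟩
  · have hδC := hC.coh α hαΛ hα δ hδ (isLimitPt_of_dropSeq h)
    have hiff := isLimitPt_dropSeq_iff h hδ.le
    ext m
    by_cases hl : IsLimitPt D α
    · rw [mem_dropSeq_of_isLimitPt (hiff.1 hl), mem_inter_iff, mem_dropSeq_of_isLimitPt hl, hδC]
      constructor
      · rintro ⟨β, hβ, hg⟩
        exact ⟨⟨β, hβ.1, hg⟩, mem_Iio.2 (lt_of_le_of_lt hg.1.2 hβ.2)⟩
      · rintro ⟨⟨β, hβ, hg⟩, hm⟩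
        refine ⟨β, ⟨hβ, ?_⟩, hg⟩
        by_contra! hle
        exact (hg.2 ⟨hD.closed δ (hδ.trans hαΛ) (hiff.1 hl), mem_Iic.2 (not_lt.1 hle)⟩).not_gt hm
    · rw [mem_dropSeq_of_not_isLimitPt (fun h' => hl (hiff.2 h')), mem_inter_iff,
        mem_dropSeq_of_not_isLimitPt hl, hδC]
      constructor
      · rintro ⟨⟨h1, h2⟩, h3⟩
        refine ⟨⟨h1, fun d hd hd' => ?_⟩, h2⟩
        obtain ⟨m', hm', -, h4⟩ := h.2 0 h.pos
        exact h3 d hd ((((mem_dropSeq_of_not_isLimitPt hl).1 hm').2 d hd hd').trans h4)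
      · rintro ⟨⟨h1, h3⟩, h2⟩
        exact ⟨⟨h1, h2⟩, fun d hd hd' => h3 d hd (hd'.trans hδ)⟩

theorem mk_dropSeq_le (α : Ordinal.{u}) : #(dropSeq C D α) ≤ #(C α) := by
  by_cases hl : IsLimitPt D α
  · refine (mk_le_mk_of_subset (t := (fun β => sSup (D ∩ Iic β)) '' C α) fun m hm => ?_).trans
      mk_image_le
    obtain ⟨β, hβ, hg⟩ := (mem_dropSeq_of_isLimitPt hl).1 hm
    exact ⟨β, hβ, hg.csSup_eq⟩
  · exact mk_le_mk_of_subset fun m hm => ((mem_dropSeq_of_not_isLimitPt hl).1 hm).1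

/-- The bound `κ` on order types is carried along as a bound on the sizes of proper initial
segments, which passes to images. A projection below `d ∈ D` comes from a point below `d`. -/
theorem mk_dropSeq_inter_Iio_lt {κ : Cardinal.{u + 1}} {α : Ordinal.{u}}
    (hsmall : ∀ β < α, #(C α ∩ Iio β : Set Ordinal.{u}) < κ)
    {β : Ordinal.{u}} (hβ : β < α) : #(dropSeq C D α ∩ Iio β : Set Ordinal.{u}) < κ := by
  by_cases hl : IsLimitPt D α
  · obtain ⟨d, hd, h1, h2⟩ := hl.2 β hβ
    refine (mk_le_mk_of_subset (t := (fun β => sSup (D ∩ Iic β)) '' (C α ∩ Iio d))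
      fun m hm => ?_).trans_lt (mk_image_le.trans_lt (hsmall d h2))
    obtain ⟨β', hβ', hg⟩ := (mem_dropSeq_of_isLimitPt hl).1 hm.1
    refine ⟨β', ⟨hβ', ?_⟩, hg.csSup_eq⟩
    by_contra! hle
    exact (hg.2 ⟨hd, mem_Iic.2 (not_lt.1 hle)⟩).not_gt (hm.2.trans h1)
  · refine (mk_le_mk_of_subset (fun m hm => ?_)).trans_lt (hsmall β hβ)
    exact ⟨((mem_dropSeq_of_not_isLimitPt hl).1 hm.1).1, hm.2⟩

end dropSeq

/-! ### Club guessing. -/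

/-- Club guessing for coherent sequences: some drop of `C` guesses clubs on `G`. -/
theorem exists_dropSeq_guess {Λ : Ordinal.{u}} {κ ρ : Cardinal.{u}} (hκ : ℵ₀ < κ) (hρ : ρ < κ)
    (hΛ : κ < Λ.cof) {C : Ordinal.{u} → Set Ordinal.{u}}
    {G : Set Ordinal.{u}} (hG : Stationary G Λ)
    (hcard : ∀ α ∈ G, #(C α) ≤ Cardinal.lift.{u + 1} ρ) (hlt : ∀ α ∈ G, ∀ β ∈ C α, β < α) :
    ∃ D, Club D Λ ∧ ∀ E, Club E Λ → ∃ α ∈ G, dropSeq C D α ⊆ E := by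
  by_contra! hno
  have hΛ' := hκ.trans hΛ
  choose! F hF hF' using hno
  let Di : Ordinal.{u} → Set Ordinal.{u} :=
    -- `F D` is a club containing no drop along `D` at a point of `G`; `Di i` lies inside all the `F
    -- (Di j)` with `j < i`.
    WellFoundedLT.fix fun i ih => {x | x < Λ ∧ ∀ j, (hj : j < i) → x ∈ F (ih j hj)}
  have hDi : ∀ i, Di i = {x | x < Λ ∧ ∀ j < i, x ∈ F (Di j)} := fun i => WellFoundedLT.fix_eq ..
  -- Regular and larger than every `C α` with `α ∈ G`, yet at most `κ`, so that the intersections of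
  -- clubs below remain clubs.
  let σ := (succ (max ρ ℵ₀)).ord
  have hσκ : succ (max ρ ℵ₀) ≤ κ := succ_le_of_lt (max_lt hρ hκ)
  have hreg : σ.cof = succ (max ρ ℵ₀) := (isRegular_succ (le_max_right _ _)).cof_ord
  have hσlim : IsSuccLimit σ := isSuccLimit_of_uncountable_cof
    (hreg ▸ lt_succ_of_le (le_max_right _ _))
  have hclub : ∀ i ≤ σ, Club (Di i) Λ := fun i => by
    induction i using WellFoundedLT.induction with
    | ind i ih =>
      intro hi
      rw [hDi]
      refine Club.iInter hΛ' ?_ fun j hj => hF _ (ih j hj (hj.le.trans hi))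
      refine lt_of_le_of_lt ?_ hΛ
      exact (Ordinal.card_le_card hi).trans (by rwa [card_ord])
  have hanti : ∀ i j, i ≤ j → Di j ⊆ Di i := fun i j hij x hx => by
    rw [hDi] at hx ⊢
    exact ⟨hx.1, fun k hk => hx.2 k (hk.trans_le hij)⟩
  obtain ⟨α, hαG, hαΛ, hαlim⟩ := hG _ ((hclub σ le_rfl).limitPts hΛ')
  -- The projection of `β` to `Di i`, shifted by `succ` so that the value `0` means that there is
  -- none.
  let m : Ordinal.{u} → Ordinal.{u} → Ordinal.{u} := fun i β => sSup (succ '' (Di i ∩ Iic β))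
  have hbdd : ∀ i β, BddAbove (succ '' (Di i ∩ Iic β)) := fun i β =>
    ⟨succ β, by rintro _ ⟨x, hx, rfl⟩; exact succ_le_succ hx.2⟩
  have hgreat : ∀ {i β x}, IsGreatest (Di i ∩ Iic β) x → m i β = succ x := fun {i β x} hx => by
    refine IsGreatest.csSup_eq ⟨⟨x, hx.1, rfl⟩, ?_⟩
    rintro _ ⟨y, hy, rfl⟩
    exact succ_le_succ (hx.2 hy)
  have hmin : ∀ β, ∃ i < σ, ∀ j < σ, m i β ≤ m j β := fun β => by
    obtain ⟨_, ⟨i, hi, rfl⟩, h'⟩ := WellFounded.has_min (α := Ordinal.{u}) wellFounded_lt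
      ((m · β) '' Iio σ) ⟨_, 0, hσlim.bot_lt, rfl⟩
    exact ⟨i, hi, fun j hj => not_lt.1 (h' _ ⟨j, hj, rfl⟩)⟩
  choose I hI hI' using hmin
  -- For each `β` the projections decrease with `i` and so are constant from `I β` on. As `C α` is
  -- small, one `i < σ` serves all its points; its drop is then also the drop along `Di (succ i)`,
  -- hence inside `F (Di i)`.
  have hsup : sSup (I '' C α) < σ := by
    refine sSup_lt_of_lt_cof (mk_image_le.trans_lt ((hcard α hαG).trans_lt ?_)) ?_
    · rw [← Ordinal.lift_cof, Cardinal.lift_lt, hreg]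
      exact lt_succ_of_le (le_max_left _ _)
    · rintro _ ⟨β, -, rfl⟩
      exact hI β
  have hsm : Small.{u} (C α) := small_subset (t := C α) (s := Iio α) (hlt α hαG)
  set i := sSup (I '' C α) with hi
  refine hF' _ (hclub i hsup.le) α hαG fun x hx => ?_
  rw [mem_dropSeq_of_isLimitPt (hαlim.mono (hanti _ _ hsup.le))] at hx
  obtain ⟨β, hβ, hg⟩ := hx
  have hIi : I β ≤ i := le_csSup Ordinal.bddAbove_of_small ⟨β, hβ, rfl⟩
  have hsi : succ i < σ := hσlim.succ_lt hsup
  have hle : m i β ≤ m (succ i) β := by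
    refine le_trans ?_ (hI' β _ hsi)
    exact csSup_le' fun y hy => le_csSup (hbdd _ _)
      (image_mono (inter_subset_inter_left _ (hanti _ _ hIi)) hy)
  have hne : (Di (succ i) ∩ Iic β).Nonempty := by
    by_contra! hem
    rw [hgreat hg] at hle
    simp only [m, hem, image_empty, csSup_empty] at hle
    exact (bot_lt_succ x).not_ge hle
  obtain ⟨y, hy⟩ := (hclub _ hsi.le).exists_isGreatest (((hlt α hαG) β hβ).trans hαΛ) hne
  rw [hgreat hg, hgreat hy, succ_le_succ_iff] at hle
  have hyx : y = x := le_antisymm (hg.2 ⟨hanti _ _ (le_succ i) hy.1.1, hy.1.2⟩) hle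
  have := hy.1.1
  rw [hDi] at this
  exact hyx ▸ this.2 i (lt_succ i)

/-! ### Thinning a club by guesses at its consecutive pairs. -/

/-- `a < b` are consecutive elements of `C`. -/
def Consec (C : Set Ordinal.{u}) (a b : Ordinal.{u}) : Prop :=
  a ∈ C ∧ b ∈ C ∧ a < b ∧ ∀ x ∈ C, x < b → x ≤ a

theorem consec_inter_Iio {C : Set Ordinal.{u}} {a b δ : Ordinal.{u}} :
    Consec (C ∩ Iio δ) a b ↔ Consec C a b ∧ b < δ := by
  constructor
  · rintro ⟨h1, h2, h3, h4⟩
    exact ⟨⟨h1.1, h2.1, h3, fun x hx hxb => h4 x ⟨hx, hxb.trans h2.2⟩ hxb⟩, h2.2⟩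
  · rintro ⟨⟨h1, h2, h3, h4⟩, h5⟩
    exact ⟨⟨h1, h3.trans h5⟩, ⟨h2, h5⟩, h3, fun x hx => h4 x hx.1⟩

theorem Consec.le_left {C : Set Ordinal.{u}} {a b x : Ordinal.{u}} (h : Consec C a b) (hx : x ∈ C)
    (hxb : x < b) : x ≤ a := h.2.2.2 x hx hxb

section Thinning

variable (𝒢 : Ordinal.{u} → Ordinal.{u} → Set (Set Ordinal.{u}))

/-- The upper ends of the consecutive pairs of `C` at which `𝒢` makes some guess. -/
def guessPts (C : Set Ordinal.{u}) : Set Ordinal.{u} :=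
  {b | ∃ a, Consec C a b ∧ (𝒢 a b).Nonempty}

/-- The points of `C` at which some guess contradicts an earlier one. -/
def conflictPts (C : Set Ordinal.{u}) : Set Ordinal.{u} :=
  -- Since `b = b'` is allowed, two different guesses at the same pair also conflict.
  {b' | ∃ a b a', Consec C a b ∧ Consec C a' b' ∧ b ≤ b' ∧
    ∃ T ∈ 𝒢 a b, ∃ T' ∈ 𝒢 a' b', T ≠ T' ∩ Iio a}

/-- The club in `α` carved out of the club `C` by the guesses. -/
noncomputable def thin (C : Set Ordinal.{u}) (α : Ordinal.{u}) : Set Ordinal.{u} :=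
  open Classical in
  if (conflictPts 𝒢 C).Nonempty then {x | x ∈ C ∧ ∃ w ∈ conflictPts 𝒢 C, w < x}
  else if IsLimitPt (guessPts 𝒢 C) α then
    {x | x < α ∧ (x ∈ guessPts 𝒢 C ∨ IsLimitPt (guessPts 𝒢 C) x)}
  else {x | x ∈ C ∧ ∀ b ∈ guessPts 𝒢 C, b < x}

/-- The union of the guesses along `C`, provided that they cohere and are cofinal in `α`. -/
noncomputable def thinSet (C : Set Ordinal.{u}) (α : Ordinal.{u}) : Set Ordinal.{u} :=
  open Classical in
  if ¬ (conflictPts 𝒢 C).Nonempty ∧ IsLimitPt (guessPts 𝒢 C) α then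
    {x | ∃ a b, Consec C a b ∧ ∃ T ∈ 𝒢 a b, x ∈ T}
  else ∅

variable {𝒢} {C : Set Ordinal.{u}} {α δ : Ordinal.{u}}

theorem guessPts_subset : guessPts 𝒢 C ⊆ C := fun _ ⟨_, h, _⟩ => h.2.1

theorem conflictPts_subset : conflictPts 𝒢 C ⊆ C := fun _ ⟨_, _, _, _, h, _⟩ => h.2.1

theorem guessPts_inter_Iio : guessPts 𝒢 (C ∩ Iio δ) = guessPts 𝒢 C ∩ Iio δ := by
  ext b
  simp only [guessPts, consec_inter_Iio, mem_ofPred_eq, mem_inter_iff, mem_Iio]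
  tauto

theorem conflictPts_inter_Iio : conflictPts 𝒢 (C ∩ Iio δ) = conflictPts 𝒢 C ∩ Iio δ := by
  ext b
  simp only [conflictPts, consec_inter_Iio, mem_ofPred_eq, mem_inter_iff, mem_Iio]
  constructor
  · rintro ⟨a, b', a', h1, h2, h3, h4⟩
    exact ⟨⟨a, b', a', h1.1, h2.1, h3, h4⟩, h2.2⟩
  · rintro ⟨⟨a, b', a', h1, h2, h3, h4⟩, h5⟩
    exact ⟨a, b', a', ⟨h1, h3.trans_lt h5⟩, ⟨h2, h5⟩, h3, h4⟩

theorem isLimitPt_of_thin (h : IsLimitPt (thin 𝒢 C α) δ) : IsLimitPt C δ := by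
  unfold thin at h
  split_ifs at h
  · exact h.mono fun x hx => hx.1
  · exact (h.trans fun x hx => hx.2).mono guessPts_subset
  · exact h.mono fun x hx => hx.1

theorem thin_subset (hC : Club C α) : thin 𝒢 C α ⊆ C := by
  intro x hx
  unfold thin at hx
  split_ifs at hx
  · exact hx.1
  · exact hx.2.elim (fun h => guessPts_subset h) fun h => hC.closed x hx.1 (h.mono guessPts_subset)
  · exact hx.1

theorem Club.thin (hC : Club C α) (hα : α ≠ 0) : Club (thin 𝒢 C α) α := by
  refine ⟨fun x hx => hC.lt x (thin_subset hC hx), fun γ hγ => ?_, fun ε hε h => ?_⟩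
  · unfold OstSquare.thin
    split_ifs with h1 h2
    · obtain ⟨w, hw⟩ := h1
      obtain ⟨x, hx, h'⟩ := hC.unbdd _ (max_lt hγ (hC.lt w (conflictPts_subset hw)))
      exact ⟨x, ⟨hx, w, hw, (le_max_right _ _).trans_lt h'⟩, (le_max_left _ _).trans_lt h'⟩
    · obtain ⟨x, hx, h3, h4⟩ := h2.2 γ hγ
      exact ⟨x, ⟨h4, .inl hx⟩, h3⟩
    · have : ∃ γ' < α, ∀ b ∈ guessPts 𝒢 C, b ≤ γ' := by
        by_contra! hno
        exact h2 ⟨hα, fun γ hγ => by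
          obtain ⟨b, h3, h4⟩ := hno γ hγ
          exact ⟨b, h3, h4, hC.lt b (guessPts_subset h3)⟩⟩
      obtain ⟨γ', hγ', h'⟩ := this
      obtain ⟨x, hx, h3⟩ := hC.unbdd _ (max_lt hγ hγ')
      exact ⟨x, ⟨hx, fun b hb => (h' b hb).trans_lt ((le_max_right _ _).trans_lt h3)⟩,
        (le_max_left _ _).trans_lt h3⟩
  · have hεC := hC.closed ε hε (isLimitPt_of_thin h)
    obtain ⟨m, hm, -, hmε⟩ := h.2 0 h.pos
    unfold OstSquare.thin at h hm ⊢
    split_ifs at h hm ⊢ with h1 h2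
    · obtain ⟨-, w, hw, h'⟩ := hm
      exact ⟨hεC, w, hw, h'.trans hmε⟩
    · exact ⟨hε, .inr (h.trans fun x hx => hx.2)⟩
    · exact ⟨hεC, fun b hb => (hm.2 b hb).trans hmε⟩

/-- A single point `m < δ` of the thinned club fixes the branch: either a conflict already occurs
below `m`, or all guess points lie below `m`. In the remaining branch guess points accumulate at `δ`
itself. -/
theorem thin_coherent (hδ : δ < α) (h : IsLimitPt (thin 𝒢 C α) δ) :
    thin 𝒢 (C ∩ Iio δ) δ = thin 𝒢 C α ∩ Iio δ ∧
    ((conflictPts 𝒢 (C ∩ Iio δ)).Nonempty ↔ (conflictPts 𝒢 C).Nonempty) ∧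
    (¬ (conflictPts 𝒢 C).Nonempty →
      (IsLimitPt (guessPts 𝒢 (C ∩ Iio δ)) δ ↔ IsLimitPt (guessPts 𝒢 C) α)) := by
  obtain ⟨m, hm, -, hmδ⟩ := h.2 0 h.pos
  unfold thin at h hm ⊢
  rw [conflictPts_inter_Iio, guessPts_inter_Iio]
  by_cases h1 : (conflictPts 𝒢 C).Nonempty
  · rw [if_pos h1] at h hm
    obtain ⟨-, w, hw, hwm⟩ := hm
    have h1' : (conflictPts 𝒢 C ∩ Iio δ).Nonempty := ⟨w, hw, hwm.trans hmδ⟩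
    refine ⟨?_, by simp [h1, h1'], fun h' => (h' h1).elim⟩
    rw [if_pos h1, if_pos h1']
    ext x
    constructor
    · rintro ⟨hx, w, hw, hwx⟩
      exact ⟨⟨hx.1, w, hw.1, hwx⟩, hx.2⟩
    · rintro ⟨⟨hx, w, hw, hwx⟩, hxδ⟩
      exact ⟨⟨hx, hxδ⟩, w, ⟨hw, hwx.trans hxδ⟩, hwx⟩
  · have h1' : ¬ (conflictPts 𝒢 C ∩ Iio δ).Nonempty := fun h' => h1 h'.left
    simp only [h1, h1', if_false, true_and, not_false_eq_true, forall_const] at h hm ⊢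
    by_cases h2 : IsLimitPt (guessPts 𝒢 C) α
    · rw [if_pos h2] at h
      have h2' : IsLimitPt (guessPts 𝒢 C ∩ Iio δ) δ :=
        (h.trans fun x hx => hx.2).of_subset fun x hx hx' => ⟨hx, hx'⟩
      refine ⟨?_, by simp [h2, h2']⟩
      rw [if_pos h2, if_pos h2']
      ext x
      constructor
      · rintro ⟨hx, h3⟩
        exact ⟨⟨hx.trans hδ, h3.imp (·.1) (·.mono inter_subset_left)⟩, hx⟩
      · rintro ⟨⟨-, h3⟩, hx⟩
        exact ⟨hx, h3.imp (⟨·, hx⟩) fun h4 => h4.of_subset fun y hy hy' => ⟨hy, hy'.trans hx⟩⟩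
    · rw [if_neg h2] at h hm
      have h2' : ¬ IsLimitPt (guessPts 𝒢 C ∩ Iio δ) δ := fun h' => by
        obtain ⟨b, hb, h3, h4⟩ := h'.2 m hmδ
        exact (hm.2 b hb.1).not_gt h3
      refine ⟨?_, by simp [h2, h2']⟩
      rw [if_neg h2, if_neg h2']
      ext x
      constructor
      · rintro ⟨hx, h3⟩
        exact ⟨⟨hx.1, fun b hb => h3 b ⟨hb, (hm.2 b hb).trans hmδ⟩⟩, hx.2⟩
      · rintro ⟨⟨hx, h3⟩, hx'⟩
        exact ⟨⟨hx, hx'⟩, fun b hb => h3 b hb.1⟩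

theorem thinSet_coherent (h𝒢 : ∀ a b, ∀ T ∈ 𝒢 a b, T ⊆ Iio a) (hδ : δ < α)
    (h : IsLimitPt (thin 𝒢 C α) δ) :
    thinSet 𝒢 (C ∩ Iio δ) δ = thinSet 𝒢 C α ∩ Iio δ := by
  obtain ⟨-, h1, h2⟩ := thin_coherent hδ h
  unfold thinSet
  rw [h1]
  by_cases h3 : ¬ (conflictPts 𝒢 C).Nonempty ∧ IsLimitPt (guessPts 𝒢 C) α
  · have h3' := (h2 h3.1).2 h3.2
    rw [if_pos h3, if_pos ⟨h3.1, h3'⟩]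
    ext x
    constructor
    · rintro ⟨a, b, hab, T, hT, hx⟩
      rw [consec_inter_Iio] at hab
      exact ⟨⟨a, b, hab.1, T, hT, hx⟩, (h𝒢 a b T hT hx).trans (hab.1.2.2.1.trans hab.2)⟩
    · rintro ⟨⟨a, b, hab, T, hT, hx⟩, hxδ⟩
      -- Two guess points are taken above `x` so that the lower end `a₂ ≥ b₁` of the second pair
      -- exceeds `x`; absence of conflict then transfers `x` to a guess made below `δ`.
      obtain ⟨b₁, hb₁, h4, h5⟩ := h3'.2 x hxδ
      obtain ⟨b₂, ⟨a₂, hab₂, T₂, hT₂⟩, h6, h7⟩ := h3'.2 b₁ h5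
      rw [consec_inter_Iio] at hab₂
      have hxa : x < a₂ := h4.trans_le (hab₂.1.le_left (guessPts_subset hb₁).1 h6)
      rcases le_or_gt b₂ b with hle | hlt
      · refine ⟨a₂, b₂, consec_inter_Iio.2 hab₂, T₂, hT₂, ?_⟩
        have : T₂ = T ∩ Iio a₂ := by
          by_contra hne
          exact h3.1 ⟨b, a₂, b₂, a, hab₂.1, hab, hle, T₂, hT₂, T, hT, hne⟩
        rw [this]
        exact ⟨hx, hxa⟩
      · exact ⟨a, b, consec_inter_Iio.2 ⟨hab, hlt.trans h7⟩, T, hT, hx⟩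
  · rw [if_neg h3, if_neg, empty_inter]
    rintro ⟨h4, h5⟩
    exact h3 ⟨h4, (h2 h4).1 h5⟩

/-- Guesses that are all initial segments of one set `A` cannot conflict, and cofinally many of them
exhaust `A ∩ Iio α`. -/
theorem thinSet_eq {A : Set Ordinal.{u}} (hC : Club C α) (hα : α ≠ 0)
    (hA : ∀ a b, Consec C a b → ∀ T ∈ 𝒢 a b, T = A ∩ Iio a)
    (hB : ∀ γ < α, ∃ a b, γ < b ∧ Consec C a b ∧ (𝒢 a b).Nonempty) :
    thinSet 𝒢 C α = A ∩ Iio α := by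
  have h1 : ¬ (conflictPts 𝒢 C).Nonempty := by
    rintro ⟨b', a, b, a', hab, hab', hle, T, hT, T', hT', hne⟩
    refine hne ?_
    rw [hA a b hab T hT, hA a' b' hab' T' hT', inter_assoc, Iio_inter_Iio, min_eq_right]
    rcases hle.lt_or_eq with h | rfl
    · exact hab.2.2.1.le.trans (hab'.le_left hab.2.1 h)
    · exact hab'.le_left hab.1 hab.2.2.1
  have h2 : IsLimitPt (guessPts 𝒢 C) α := ⟨hα, fun γ hγ => by
    obtain ⟨a, b, h3, h4, h5⟩ := hB γ hγ
    exact ⟨b, ⟨a, h4, h5⟩, h3, hC.lt b h4.2.1⟩⟩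
  unfold thinSet
  rw [if_pos ⟨h1, h2⟩]
  ext x
  constructor
  · rintro ⟨a, b, hab, T, hT, hx⟩
    rw [hA a b hab T hT] at hx
    exact ⟨hx.1, lt_trans hx.2 (hC.lt a hab.1)⟩
  · rintro ⟨hx, hxα⟩
    obtain ⟨b₁, hb₁, h4, h5⟩ := h2.2 x hxα
    obtain ⟨b₂, ⟨a₂, hab₂, T₂, hT₂⟩, h6, h7⟩ := h2.2 b₁ h5
    refine ⟨a₂, b₂, hab₂, T₂, hT₂, ?_⟩
    rw [hA a₂ b₂ hab₂ T₂ hT₂]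
    exact ⟨hx, h4.trans_le (hab₂.le_left (guessPts_subset hb₁) h6)⟩

theorem CoherentClubs.thin {Λ : Ordinal.{u}} {C : Ordinal.{u} → Set Ordinal.{u}}
    (hC : CoherentClubs Λ C) : CoherentClubs Λ fun α => thin 𝒢 (C α) α where
  club α hαΛ hα := (hC.club α hαΛ hα).thin hα.bot_lt.ne'
  coh α hαΛ hα δ hδ h := by
    rw [hC.coh α hαΛ hα δ hδ (isLimitPt_of_thin h)]
    exact (thin_coherent hδ h).1

theorem CoherentClubs.thinSet {Λ : Ordinal.{u}} {C : Ordinal.{u} → Set Ordinal.{u}}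
    (hC : CoherentClubs Λ C) (h𝒢 : ∀ a b, ∀ T ∈ 𝒢 a b, T ⊆ Iio a) :
    CoherentSets Λ (fun α => OstSquare.thin 𝒢 (C α) α) fun α => OstSquare.thinSet 𝒢 (C α) α :=
  fun α hαΛ hα δ hδ h => by
    dsimp only
    rw [hC.coh α hαΛ hα δ hδ (isLimitPt_of_thin h)]
    exact thinSet_coherent h𝒢 hδ h

end Thinning

/-! ### The built-in diamond by diagonalisation over matrices. -/

theorem card_le_of_lt_ord_succ {κ : Cardinal.{u}} {β : Ordinal.{u}} (hβ : β < (succ κ).ord) :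
    β.card ≤ κ :=
  lt_succ_iff.1 (lt_ord.1 hβ)

/-- Ordinals below `κ⁺` inject into `κ`. -/
theorem exists_injOn_lt_ord {κ : Cardinal.{u}} {β : Ordinal.{u}} (hβ : β < (succ κ).ord) :
    ∃ e : Ordinal.{u} → Ordinal.{u}, InjOn e (Iio β) ∧ ∀ γ < β, e γ < κ.ord := by
  have : #(Iio β) ≤ #(Iio κ.ord) := by
    rw [Cardinal.mk_Iio_ordinal, Cardinal.mk_Iio_ordinal, card_ord, Cardinal.lift_le]
    exact card_le_of_lt_ord_succ hβ
  obtain ⟨e⟩ := this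
  refine ⟨fun γ => if h : γ < β then e ⟨γ, h⟩ else 0, fun x hx y hy hxy => ?_, fun γ hγ => ?_⟩
  · have hx' : x < β := hx
    have hy' : y < β := hy
    simp only [hx', hy', dite_true] at hxy
    exact congrArg Subtype.val (e.injective (Subtype.ext hxy))
  · simp only [hγ, dite_true]
    exact (e _).2

/-- If `2 ^ κ = κ⁺`, then there are only `κ⁺` many `κ × κ`-matrices of subsets of a given
`β < κ⁺`. -/
theorem exists_enumeration {κ : Cardinal.{u}} (hκ : ℵ₀ ≤ κ) (hch : LocalCH κ) {β : Ordinal.{u}}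
    (hβ : β < (succ κ).ord) :
    ∃ X : Ordinal.{u} → Ordinal.{u} → Ordinal.{u} → Set Ordinal.{u},
      ∀ f : Ordinal.{u} → Ordinal.{u} → Set Ordinal.{u}, ∃ γ < (succ κ).ord,
        ∀ i < κ.ord, ∀ τ < κ.ord, X γ i τ = f i τ ∩ Iio β := by
  -- A matrix of subsets of `β` is a subset of `κ × κ × β`, and there are at most `2 ^ κ` of these.
  have : #(Set (Iio κ.ord × Iio κ.ord × Iio β)) ≤ #(Iio (succ κ).ord) := by
    simp only [mk_set, mk_prod, Cardinal.lift_id, Cardinal.mk_Iio_ordinal, card_ord]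
    rw [← Cardinal.lift_mul, ← Cardinal.lift_mul, ← Cardinal.lift_two_power, Cardinal.lift_le,
      ← show 2 ^ κ = succ κ from hch]
    refine Cardinal.power_le_power_left two_ne_zero ?_
    calc κ * (κ * β.card) ≤ κ * (κ * κ) := by gcongr; exact card_le_of_lt_ord_succ hβ
      _ = κ := by rw [mul_eq_self hκ, mul_eq_self hκ]
  obtain ⟨code⟩ := this
  refine ⟨fun γ i τ => {x | ∃ P, (code P : Ordinal) = γ ∧ ∃ (hi : i < κ.ord) (hτ : τ < κ.ord)
    (hx : x < β), (⟨i, hi⟩, ⟨τ, hτ⟩, ⟨x, hx⟩) ∈ P}, fun f => ?_⟩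
  refine ⟨code {p | (p.2.2 : Ordinal) ∈ f p.1 p.2.1}, (code _).2, fun i hi τ hτ => ?_⟩
  ext x
  constructor
  · rintro ⟨P, hP, _, _, hx, h⟩
    rw [Subtype.val_inj, code.injective.eq_iff] at hP
    subst hP
    exact ⟨h, hx⟩
  · rintro ⟨h, hx⟩
    exact ⟨_, rfl, hi, hτ, hx, h⟩

theorem Club.exists_consec {C : Set Ordinal.{u}} {α γ : Ordinal.{u}} (hC : Club C α) (hγ : γ < α) :
    ∃ a b, Consec C a b ∧ γ < a := by
  obtain ⟨a, ha, hγa⟩ := hC.unbdd γ hγ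
  have hne : {b | b ∈ C ∧ a < b}.Nonempty := hC.unbdd a (hC.lt a ha)
  have hb := csInf_mem hne
  refine ⟨a, sInf {b | b ∈ C ∧ a < b}, ⟨ha, hb.1, hb.2, fun _ hx hxb => ?_⟩, hγa⟩
  by_contra! hax
  exact notMem_of_lt_csInf' hxb ⟨hx, hax⟩

theorem Consec.csSup_eq {C : Set Ordinal.{u}} {a b : Ordinal.{u}} (h : Consec C a b) :
    sSup (C ∩ Iio b) = a :=
  IsGreatest.csSup_eq ⟨⟨h.1, h.2.2.1⟩, fun _ hx => h.le_left hx.1 hx.2⟩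

/-- Given enumerations `X a` of matrices of subsets of `a` and functions `e b` on `b`, the guesses
for the `(i, τ)` entry at a consecutive pair `(a, b)`: the entries of those matrices whose index has
`e b`-value below `i` and which agree with `Y` before `τ`. -/
def matrixGuess (X : Ordinal.{u} → Ordinal.{u} → Ordinal.{u} → Ordinal.{u} → Set Ordinal.{u})
    (e : Ordinal.{u} → Ordinal.{u} → Ordinal.{u}) (i τ : Ordinal.{u})
    (Y : Ordinal.{u} → Set Ordinal.{u}) (a b : Ordinal.{u}) : Set (Set Ordinal.{u}) :=
  {T | ∃ γ < b, e b γ < i ∧ (∀ τ' < τ, X a γ i τ' = Y τ' ∩ Iio a) ∧ T = X a γ i τ ∩ Iio a}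

/-- A coherent sequence that guesses clubs on `G` can be thinned out to one with a built-in
diamond. -/
theorem exists_thin_guess {κ ρ : Cardinal.{u}} (hκ : ℵ₀ < κ) (hch : LocalCH κ) (hρ : ρ < κ)
    {C : Ordinal.{u} → Set Ordinal.{u}} (hC : CoherentClubs (succ κ).ord C) {G : Set Ordinal.{u}}
    (hG : ∀ α ∈ G, α < (succ κ).ord ∧ IsSuccLimit α ∧ α.cof ≠ κ.ord.cof)
    (hcard : ∀ α ∈ G, #(C α) ≤ Cardinal.lift.{u + 1} ρ)
    (hguess : ∀ E, Club E (succ κ).ord → ∃ α ∈ G, C α ⊆ E) :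
    ∃ c S, CoherentClubs (succ κ).ord c ∧ CoherentSets (succ κ).ord c S ∧
      (∀ α < (succ κ).ord, IsSuccLimit α → c α ⊆ C α) ∧
      ∀ D A, Club D (succ κ).ord → ∃ α ∈ G, c α ⊆ D ∧ S α = A ∩ Iio α := by
  have hreg := (isRegular_succ hκ.le).cof_ord
  have hΛ : ℵ₀ < (succ κ).ord.cof := hκ.trans (hreg.symm ▸ lt_succ κ)
  have hκlim : IsSuccLimit κ.ord := isSuccLimit_ord hκ.le
  choose! X hX using fun β hβ => exists_enumeration (β := β) hκ.le hch hβ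
  choose! e he he' using fun β hβ => exists_injOn_lt_ord (κ := κ) (β := β) hβ
  by_contra hno
  have hfail : ∀ i τ Y, ∃ D A, Club D (succ κ).ord ∧ ∀ α ∈ G,
      thin (matrixGuess X e i τ Y) (C α) α ⊆ D →
      thinSet (matrixGuess X e i τ Y) (C α) α ≠ A ∩ Iio α := fun i τ Y => by
    by_contra! h
    refine hno ⟨_, _, hC.thin, hC.thinSet ?_, fun α hαΛ hα => thin_subset (hC.club α hαΛ hα),
      fun D A hD => h D A hD⟩
    rintro a b _ ⟨γ, -, -, -, rfl⟩
    exact inter_subset_right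
  choose D A hD hDA using hfail
  -- Row `i` of a matrix of counterexamples: entry `τ` is a set that is not guessed when the guesses
  -- consult the entries of row `i` before `τ`.
  let Y : Ordinal.{u} → Ordinal.{u} → Set Ordinal.{u} := fun i =>
    WellFoundedLT.fix fun τ ih => A i τ fun τ' => {x | ∃ h : τ' < τ, x ∈ ih τ' h}
  let Y' : Ordinal.{u} → Ordinal.{u} → Ordinal.{u} → Set Ordinal.{u} := fun i τ τ' =>
    {x | τ' < τ ∧ x ∈ Y i τ'}
  have hY : ∀ i τ, Y i τ = A i τ (Y' i τ) := fun i τ => by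
    simp only [Y']
    rw [show Y i τ = _ from WellFoundedLT.fix_eq ..]
    simp only [exists_prop]
    rfl
  have hY' : ∀ i τ, ∀ τ' < τ, Y' i τ τ' = Y i τ' := fun i τ τ' h => by
    ext x
    exact and_iff_right h
  -- `g β` is the index of `Y` restricted to `β`.
  choose! g hg hg' using fun β hβ => hX β hβ Y
  have hE := (club_closure_points hΛ (by rw [hreg]) hg).inter hΛ
    (Club.iInter hΛ (o := κ.ord) (by rw [card_ord, hreg]; exact lt_succ κ) fun i _ =>
      Club.iInter hΛ (o := κ.ord) (by rw [card_ord, hreg]; exact lt_succ κ) fun τ _ =>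
        hD i τ (Y' i τ))
  obtain ⟨α, hαG, hαE⟩ := hguess _ hE
  obtain ⟨hαΛ, hα, hcof⟩ := hG α hαG
  have hCα := hC.club α hαΛ hα
  have hlt : ∀ {b}, b ∈ C α → b < (succ κ).ord := fun hb => (hCα.lt _ hb).trans hαΛ
  -- This fixes the row: at cofinally many consecutive pairs `(a, b)` the correct index `g a` has `e
  -- b`-value below `i`. The supremum recovers `a` from `b`.
  obtain ⟨i, hi, hi'⟩ := exists_bounded_on_cofinal (δ := α) hκlim hcof
    (U := {b | ∃ a, Consec (C α) a b}) (h := fun b => e b (g (sSup (C α ∩ Iio b))))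
    (fun γ hγ => by
      obtain ⟨a, b, hab, h⟩ := hCα.exists_consec hγ
      exact ⟨b, ⟨a, hab⟩, h.trans hab.2.2.1, hCα.lt b hab.2.1⟩)
    (by
      rintro b ⟨a, hab⟩
      rw [hab.csSup_eq]
      exact he' b (hlt hab.2.1) _ ((hαE hab.2.1).1.2 a hab.2.2.1))
  -- The correct index supplies true guesses cofinally often, so `Y i τ` can only be missed because
  -- some other matrix, correct before `τ`, errs at `τ`.
  have hwit : ∀ τ < κ.ord, ∃ a b γ, Consec (C α) a b ∧ γ < b ∧ e b γ < i ∧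
      (∀ τ' < τ, X a γ i τ' = Y i τ' ∩ Iio a) ∧ X a γ i τ ∩ Iio a ≠ Y i τ ∩ Iio a := by
    intro τ hτ
    by_contra! hall
    refine hDA i τ (Y' i τ) α hαG
      (fun x hx => ((hαE (thin_subset hCα hx)).2.2 i hi).2 τ hτ) ?_
    rw [← hY]
    refine thinSet_eq hCα hα.bot_lt.ne' ?_ fun γ hγ => ?_
    · rintro a b hab _ ⟨γ, h1, h2, h3, rfl⟩
      exact hall a b γ hab h1 h2 fun τ' h => by rw [h3 τ' h, hY' i τ τ' h]
    · obtain ⟨b, ⟨a, hab⟩, h1, -, h2⟩ := hi' γ hγ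
      rw [hab.csSup_eq] at h2
      refine ⟨a, b, h1, hab, _, g a, (hαE hab.2.1).1.2 a hab.2.2.1, h2, fun τ' h => ?_, rfl⟩
      rw [hg' a (hlt hab.1) i hi τ' (h.trans hτ), hY' i τ τ' h]
  choose! a b γ hab hγ hγi hbefore hat using hwit
  -- `τ` is the place of the first error in row `i` of the matrix with index `γ τ`, so `κ` many `τ`
  -- inject into a set of size less than `κ`.
  have hinj : Function.Injective fun τ : Iio κ.ord =>
      ((⟨b τ, (hab τ τ.2).2.1⟩, ⟨e (b τ) (γ τ), hγi τ τ.2⟩) : C α × Iio i) := by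
    intro τ₁ τ₂ h
    have hb : b τ₁ = b τ₂ := congrArg (fun p => (p.1 : Ordinal)) h
    have hγ' : e (b τ₁) (γ τ₁) = e (b τ₂) (γ τ₂) := congrArg (fun p => (p.2 : Ordinal)) h
    have ha : a τ₁ = a τ₂ := by
      rw [← (hab τ₁ τ₁.2).csSup_eq, ← (hab τ₂ τ₂.2).csSup_eq, hb]
    have hγeq : γ τ₁ = γ τ₂ := by
      rw [hb] at hγ'
      exact he _ (hlt (hab τ₂ τ₂.2).2.1) (hb ▸ hγ τ₁ τ₁.2) (hγ τ₂ τ₂.2) hγ'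
    have key : ∀ σ τ : Iio κ.ord, a σ = a τ → γ σ = γ τ → ¬ σ < τ := fun σ τ h1 h2 h3 => by
      refine hat σ σ.2 ?_
      rw [h1, h2, hbefore τ τ.2 σ h3, inter_assoc, inter_self]
    exact le_antisymm (not_lt.1 (key τ₂ τ₁ ha.symm hγeq.symm)) (not_lt.1 (key τ₁ τ₂ ha hγeq))
  have hle := mk_le_of_injective hinj
  rw [mk_prod, Cardinal.lift_id, Cardinal.lift_id, Cardinal.mk_Iio_ordinal, card_ord,
    Cardinal.mk_Iio_ordinal] at hle
  refine hle.not_gt ((mul_le_mul_left (hcard α hαG) _).trans_lt ?_)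
  rw [← Cardinal.lift_mul, Cardinal.lift_lt]
  exact mul_lt_of_lt hκ.le hρ (lt_ord.1 hi)

/-! ### Order types as ranks. -/

theorem typeLT_inter_Iio {A : Set Ordinal.{u}} {x : Ordinal.{u}} (hx : x ∈ A) :
    typeLT (A ∩ Iio x : Set Ordinal.{u}) = typein (α := A) (· < ·) ⟨x, hx⟩ := by
  rw [← type_Iio_lt]
  refine type_eq.2 ⟨⟨⟨fun y => ⟨⟨y, y.2.1⟩, y.2.2⟩, fun y => ⟨y.1, y.1.2, y.2⟩, fun _ => rfl,
    fun _ => rfl⟩, Iff.rfl⟩⟩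

/-- As `κ.ord` is an initial ordinal, bounding the order type by it amounts to bounding the
cardinalities of proper initial segments. -/
theorem typeLT_le_of_mk_inter_Iio_lt {A : Set Ordinal.{u}} {κ : Cardinal.{u}}
    (h : ∀ x ∈ A, #(A ∩ Iio x : Set Ordinal.{u}) < Cardinal.lift.{u + 1} κ) :
    typeLT A ≤ Ordinal.lift.{u + 1} κ.ord := by
  refine le_of_forall_lt fun o ho => ?_
  obtain ⟨x, rfl⟩ := typein_surj _ ho
  rw [lift_ord, lt_ord, ← typeLT_inter_Iio x.2, card_type]
  exact h x x.2

theorem mk_inter_Iio_lt_of_typeLT_le {A : Set Ordinal.{u}} {κ : Cardinal.{u}}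
    (h : typeLT A ≤ Ordinal.lift.{u + 1} κ.ord) {x : Ordinal.{u}} (hx : x ∈ A) :
    #(A ∩ Iio x : Set Ordinal.{u}) < Cardinal.lift.{u + 1} κ := by
  have := (typein_lt_type (α := A) (· < ·) ⟨x, hx⟩).trans_le h
  rwa [lift_ord, lt_ord, ← typeLT_inter_Iio hx, card_type] at this

theorem Club.cof_typeLT {C : Set Ordinal.{u}} {α : Ordinal.{u}} (hC : Club C α) :
    (typeLT C).cof = Cardinal.lift.{u + 1} α.cof := by
  rw [cof_type, lift_cof, ← cof_Iio]
  refine cof_congr_of_strictMono (f := fun x : C => (⟨x, hC.lt x x.2⟩ : Iio α))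
    (fun x y hxy => hxy) fun a => ?_
  obtain ⟨β, hβ, h⟩ := hC.unbdd a a.2
  exact ⟨_, ⟨⟨β, hβ⟩, rfl⟩, h.le⟩

/-- If the `o`-th element of a club, `o` a limit, is `x`, then `x` is a limit point of the club. -/
theorem Club.isLimitPt_of_isSuccLimit {C : Set Ordinal.{u}} {α x : Ordinal.{u}} (hC : Club C α)
    (hx : x ∈ C) (h : IsSuccLimit (typeLT (C ∩ Iio x : Set Ordinal.{u}))) : IsLimitPt C x := by
  have hmax : NoMaxOrder (C ∩ Iio x : Set Ordinal.{u}) :=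
    isSuccPrelimit_type_lt_iff.1 h.isSuccPrelimit
  have hne : (C ∩ Iio x).Nonempty := by
    by_contra hem
    have : IsEmpty (C ∩ Iio x : Set Ordinal.{u}) := by
      rwa [not_nonempty_iff_eq_empty, ← isEmpty_coe_sort] at hem
    exact h.bot_lt.ne' (type_eq_zero_of_empty _)
  have hlub := isLUB_csSup hne (bddAbove_Iio.mono inter_subset_right)
  have hle : sSup (C ∩ Iio x) ≤ x := hlub.2 fun y hy => le_of_lt hy.2
  have hlt : ∀ y ∈ C ∩ Iio x, y < sSup (C ∩ Iio x) := fun y hy => by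
    obtain ⟨z, hz⟩ := exists_gt (⟨y, hy⟩ : (C ∩ Iio x : Set Ordinal.{u}))
    exact lt_of_lt_of_le hz (hlub.1 z.2)
  have hlp : IsLimitPt C (sSup (C ∩ Iio x)) := by
    refine ⟨?_, fun γ hγ => ?_⟩
    · obtain ⟨y, hy⟩ := hne
      exact (bot_le.trans_lt (hlt y hy)).ne'
    · obtain ⟨y, hy, h'⟩ := (lt_isLUB_iff hlub).1 hγ
      exact ⟨y, hy.1, h', hlt y hy⟩
  rcases hle.lt_or_eq with h' | h'
  · exact absurd (hlt _ ⟨hC.closed _ (h'.trans (hC.lt x hx)) hlp, h'⟩) (lt_irrefl _)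
  · rwa [h'] at hlp

/-- `r` measures the order types of the members of the coherent sequence `C`. -/
structure IsRank (Λ : Ordinal.{u}) (C : Ordinal.{u} → Set Ordinal.{u})
    (r : Ordinal.{u} → Ordinal.{u}) : Prop where
  lt : ∀ α < Λ, IsSuccLimit α → ∀ β < α, IsLimitPt (C α) β → r β < r α
  exists_eq : ∀ α < Λ, IsSuccLimit α → ∀ η < r α, IsSuccLimit η →
    ∃ β < α, IsLimitPt (C α) β ∧ r β = η
  cof_eq : ∀ α < Λ, IsSuccLimit α → (r α).cof = α.cof
  mk_eq : ∀ α < Λ, IsSuccLimit α → #(C α) = Cardinal.lift.{u + 1} (r α).card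

theorem IsSquareSeq.coherentClubs {κ : Cardinal.{u}} {C : Ordinal.{u} → Set Ordinal.{u}}
    (hC : IsSquareSeq κ C) : CoherentClubs (succ κ).ord C where
  club α hαΛ hα := (isClubIn_iff hα).1 (hC.club α hαΛ hα)
  coh α hαΛ hα β hβ h := hC.coherent α hαΛ hα β
    (mem_acc_iff.2 ⟨((isClubIn_iff hα).1 (hC.club α hαΛ hα)).closed β hβ h, h⟩)

theorem IsSquareSeq.exists_isRank {κ : Cardinal.{u}} {C : Ordinal.{u} → Set Ordinal.{u}}
    (hC : IsSquareSeq κ C) :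
    ∃ r, IsRank (succ κ).ord C r ∧ ∀ α < (succ κ).ord, IsSuccLimit α → r α ≤ κ.ord := by
  have hex : ∀ α, ∃ o : Ordinal.{u}, α < (succ κ).ord → IsSuccLimit α →
      Ordinal.lift.{u + 1} o = typeLT (C α) := fun α => by
    by_cases h : α < (succ κ).ord ∧ IsSuccLimit α
    · obtain ⟨o, ho⟩ := mem_range_lift_of_le (hC.otp_le α h.1 h.2)
      exact ⟨o, fun _ _ => ho⟩
    · exact ⟨0, fun h1 h2 => (h ⟨h1, h2⟩).elim⟩
  choose r hr using hex
  have hcc := hC.coherentClubs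
  refine ⟨r, ⟨fun α hαΛ hα β hβ h => ?_, fun α hαΛ hα η hη hηl => ?_, fun α hαΛ hα => ?_,
    fun α hαΛ hα => ?_⟩, fun α hαΛ hα => ?_⟩
  · rw [← Ordinal.lift_lt.{u + 1}, hr α hαΛ hα, hr β (hβ.trans hαΛ) h.isSuccLimit,
      hcc.coh α hαΛ hα β hβ h, typeLT_inter_Iio ((hcc.club α hαΛ hα).closed β hβ h)]
    exact typein_lt_type _ _
  · rw [← Ordinal.lift_lt.{u + 1}, hr α hαΛ hα] at hη
    obtain ⟨x, hx⟩ := typein_surj _ hη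
    have hxη : typeLT (C α ∩ Iio x : Set Ordinal.{u}) = Ordinal.lift.{u + 1} η :=
      (typeLT_inter_Iio x.2).trans hx
    have hlp := (hcc.club α hαΛ hα).isLimitPt_of_isSuccLimit x.2
      (by rwa [hxη, isSuccLimit_lift])
    have hxα := (hcc.club α hαΛ hα).lt x x.2
    refine ⟨x, hxα, hlp, ?_⟩
    rw [← Ordinal.lift_inj.{u + 1}, hr x (hxα.trans hαΛ) hlp.isSuccLimit,
      hcc.coh α hαΛ hα x hxα hlp, hxη]
  · rw [← Cardinal.lift_inj.{_, u + 1}, ← (hcc.club α hαΛ hα).cof_typeLT, ← hr α hαΛ hα, lift_cof]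
  · rw [lift_card, hr α hαΛ hα, card_type]
  · rw [← Ordinal.lift_le.{u + 1}, hr α hαΛ hα]
    exact hC.otp_le α hαΛ hα

/-! ### Gluing sequences along ranks. -/

section Glue

variable (C : Ordinal.{u} → Set Ordinal.{u}) (r : Ordinal.{u} → Ordinal.{u}) (Ξ : Set Ordinal.{u})
  (c S : Ordinal.{u} → Ordinal.{u} → Set Ordinal.{u})

/-- The accumulation points of `C α` whose rank lies in `Ξ`. -/
def rankPts (α : Ordinal.{u}) : Set Ordinal.{u} :=
  {β | β < α ∧ IsLimitPt (C α) β ∧ r β ∈ Ξ}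

/-- The least element of `Ξ` that is at least the rank of `α`. -/
noncomputable def nextRank (α : Ordinal.{u}) : Ordinal.{u} := sInf {ξ | ξ ∈ Ξ ∧ r α ≤ ξ}

/-- The coherent sequence following `c ξ` at the points whose rank is at most `ξ ∈ Ξ`, but greater
than the elements of `Ξ` below `ξ`. -/
noncomputable def glue (α : Ordinal.{u}) : Set Ordinal.{u} :=
  open Classical in
  if IsLimitPt (rankPts C r Ξ α) α then
    {x | x < α ∧ (x ∈ rankPts C r Ξ α ∨ IsLimitPt (rankPts C r Ξ α) x)}
  else {x | x ∈ c (nextRank r Ξ α) α ∧ ∀ b ∈ rankPts C r Ξ α, b < x}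

/-- The sets attached to `glue`. -/
noncomputable def glueSet (α : Ordinal.{u}) : Set Ordinal.{u} :=
  open Classical in
  if IsLimitPt (rankPts C r Ξ α) α then ∅ else S (nextRank r Ξ α) α

variable {C r Ξ c S} {Λ α δ : Ordinal.{u}}

theorem rankPts_isLimitPt (h : IsLimitPt (rankPts C r Ξ α) δ) : IsLimitPt (C α) δ :=
  h.trans fun _ hx => .inr hx.2.1

theorem glue_isLimitPt (hlim : ∀ ξ δ, IsLimitPt (c ξ α) δ → IsLimitPt (C α) δ)
    (h : IsLimitPt (glue C r Ξ c α) δ) : IsLimitPt (C α) δ := by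
  unfold glue at h
  split_ifs at h
  · exact rankPts_isLimitPt (h.trans fun x hx => hx.2)
  · exact hlim _ _ (h.mono fun x hx => hx.1)

theorem rankPts_eq (hC : CoherentClubs Λ C) (hαΛ : α < Λ) (hα : IsSuccLimit α) (hδ : δ < α)
    (h : IsLimitPt (C α) δ) : rankPts C r Ξ δ = rankPts C r Ξ α ∩ Iio δ := by
  ext x
  simp only [rankPts, mem_inter_iff, mem_ofPred_eq, mem_Iio, hC.coh α hαΛ hα δ hδ h]
  constructor
  · rintro ⟨h1, h2, h3⟩
    exact ⟨⟨h1.trans hδ, h2.mono inter_subset_left, h3⟩, h1⟩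
  · rintro ⟨⟨-, h2, h3⟩, h1⟩
    exact ⟨h1, h2.of_subset fun y hy hy' => ⟨hy, hy'.trans h1⟩, h3⟩

theorem glue_club (hαΛ : α < Λ) (hα : IsSuccLimit α)
    (hc : ∀ ξ, CoherentClubs Λ (c ξ)) : Club (glue C r Ξ c α) α := by
  have hcα := (hc (nextRank r Ξ α)).club α hαΛ hα
  refine ⟨fun x hx => ?_, fun γ hγ => ?_, fun ε hε h => ?_⟩
  · unfold glue at hx
    split_ifs at hx
    · exact hx.1
    · exact hcα.lt x hx.1
  · unfold glue
    split_ifs with h1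
    · obtain ⟨x, hx, h3, h4⟩ := h1.2 γ hγ
      exact ⟨x, ⟨h4, .inl hx⟩, h3⟩
    · have : ∃ γ' < α, ∀ b ∈ rankPts C r Ξ α, b ≤ γ' := by
        by_contra! hno
        exact h1 ⟨hα.bot_lt.ne', fun γ hγ => by
          obtain ⟨b, h3, h4⟩ := hno γ hγ
          exact ⟨b, h3, h4, h3.1⟩⟩
      obtain ⟨γ', hγ', h'⟩ := this
      obtain ⟨x, hx, h3⟩ := hcα.unbdd _ (max_lt hγ hγ')
      exact ⟨x, ⟨hx, fun b hb => (h' b hb).trans_lt ((le_max_right _ _).trans_lt h3)⟩,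
        (le_max_left _ _).trans_lt h3⟩
  · obtain ⟨m, hm, -, hmε⟩ := h.2 0 h.pos
    unfold glue at h hm ⊢
    split_ifs at h hm ⊢ with h1
    · exact ⟨hε, .inr (h.trans fun x hx => hx.2)⟩
    · exact ⟨hcα.closed ε hε (h.mono fun x hx => hx.1), fun b hb => (hm.2 b hb).trans hmε⟩

/-- In the second branch `δ` and `α` have the same next rank. An element of `Ξ` in `[r δ, r α)`
would be the rank of a point of `rankPts` of `α`, hence of a point below `m < δ`; but such a point
is either `δ` itself or of rank above `r δ`. -/
theorem glue_coherent (hC : CoherentClubs Λ C) (hr : IsRank Λ C r) (hΞ : ∀ ξ ∈ Ξ, IsSuccLimit ξ)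
    (hαΛ : α < Λ) (hα : IsSuccLimit α) (hc : ∀ ξ, CoherentClubs Λ (c ξ))
    (hS : ∀ ξ, CoherentSets Λ (c ξ) (S ξ))
    (hlim : ∀ ξ δ, IsLimitPt (c ξ α) δ → IsLimitPt (C α) δ) (hδ : δ < α)
    (h : IsLimitPt (glue C r Ξ c α) δ) :
    glue C r Ξ c δ = glue C r Ξ c α ∩ Iio δ ∧
      glueSet C r Ξ S δ = glueSet C r Ξ S α ∩ Iio δ := by
  have hδC := glue_isLimitPt hlim h
  obtain ⟨m, hm, -, hmδ⟩ := h.2 0 h.pos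
  unfold glue at h hm ⊢
  unfold glueSet
  rw [rankPts_eq hC hαΛ hα hδ hδC]
  by_cases h1 : IsLimitPt (rankPts C r Ξ α) α
  · rw [if_pos h1] at h
    have h1' : IsLimitPt (rankPts C r Ξ α ∩ Iio δ) δ :=
      (h.trans fun x hx => hx.2).of_subset fun x hx hx' => ⟨hx, hx'⟩
    rw [if_pos h1, if_pos h1', if_pos h1, if_pos h1', empty_inter]
    refine ⟨?_, rfl⟩
    ext x
    constructor
    · rintro ⟨hx, h3⟩
      exact ⟨⟨hx.trans hδ, h3.imp (·.1) (·.mono inter_subset_left)⟩, hx⟩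
    · rintro ⟨⟨-, h3⟩, hx⟩
      exact ⟨hx, h3.imp (⟨·, hx⟩) fun h4 => h4.of_subset fun y hy hy' => ⟨hy, hy'.trans hx⟩⟩
  · rw [if_neg h1] at h hm
    have h1' : ¬ IsLimitPt (rankPts C r Ξ α ∩ Iio δ) δ := fun h' => by
      obtain ⟨b, hb, h3, h4⟩ := h'.2 m hmδ
      exact (hm.2 b hb.1).not_gt h3
    have hδΞ : ∀ ξ ∈ Ξ, r δ ≤ ξ → r α ≤ ξ := fun ξ hξ hle => by
      by_contra! hlt
      rcases hle.lt_or_eq with h2 | h2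
      · obtain ⟨β, hβ, h3, h4⟩ := hr.exists_eq α hαΛ hα ξ hlt (hΞ ξ hξ)
        have hβδ : β < δ := (hm.2 β ⟨hβ, h3, h4 ▸ hξ⟩).trans hmδ
        refine (hr.lt δ (hδ.trans hαΛ) hδC.isSuccLimit β hβδ ?_).not_gt (h4 ▸ h2)
        rw [hC.coh α hαΛ hα δ hδ hδC]
        exact h3.of_subset fun y hy hy' => ⟨hy, hy'.trans hβδ⟩
      · exact (hm.2 δ ⟨hδ, hδC, h2 ▸ hξ⟩).not_gt hmδ
    have hnext : nextRank r Ξ δ = nextRank r Ξ α := by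
      unfold nextRank
      congr 1
      ext ξ
      exact and_congr_right fun hξ =>
        ⟨hδΞ ξ hξ, ((hr.lt α hαΛ hα δ hδ hδC).le.trans ·)⟩
    rw [if_neg h1, if_neg h1', if_neg h1, if_neg h1', hnext]
    have hcδ : IsLimitPt (c (nextRank r Ξ α) α) δ := h.mono fun x hx => hx.1
    refine ⟨?_, hS _ α hαΛ hα δ hδ hcδ⟩
    rw [(hc _).coh α hαΛ hα δ hδ hcδ]
    ext x
    constructor
    · rintro ⟨hx, h3⟩
      exact ⟨⟨hx.1, fun b hb => h3 b ⟨hb, (hm.2 b hb).trans hmδ⟩⟩, hx.2⟩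
    · rintro ⟨⟨hx, h3⟩, hx'⟩
      exact ⟨⟨hx, hx'⟩, fun b hb => h3 b hb.1⟩

theorem mk_glue_inter_Iio_lt (hC : CoherentClubs Λ C) (hαΛ : α < Λ) (hα : IsSuccLimit α)
    {κ : Cardinal.{u + 1}}
    (hsmall : ∀ β < α, #(C α ∩ Iio β : Set Ordinal.{u}) < κ)
    (hsmall' : ∀ ξ, ∀ β < α, #(c ξ α ∩ Iio β : Set Ordinal.{u}) < κ) {β : Ordinal.{u}}
    (hβ : β < α) : #(glue C r Ξ c α ∩ Iio β : Set Ordinal.{u}) < κ := by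
  unfold glue
  split_ifs
  · refine (mk_le_mk_of_subset fun x hx => ?_).trans_lt (hsmall β hβ)
    exact ⟨(hC.club α hαΛ hα).closed x hx.1.1 (hx.1.2.elim (·.2.1) rankPts_isLimitPt), hx.2⟩
  · refine (mk_le_mk_of_subset fun x hx => ?_).trans_lt (hsmall' (nextRank r Ξ α) β hβ)
    exact ⟨hx.1.1, hx.2⟩

/-- At points whose rank `ξ ∈ Ξ` is not a limit of `Ξ`, the glued sequence follows `c ξ`. -/
theorem glue_subset (hC : CoherentClubs Λ C) (hr : IsRank Λ C r) (hαΛ : α < Λ)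
    (hα : IsSuccLimit α) (hξ : r α ∈ Ξ) {η : Ordinal.{u}} (hη : η < r α) (hηl : IsSuccLimit η)
    (hηΞ : ∀ ξ ∈ Ξ, ξ < r α → ξ < η) :
    glue C r Ξ c α ⊆ c (r α) α ∧ glueSet C r Ξ S α = S (r α) α := by
  have hnext : nextRank r Ξ α = r α :=
    IsLeast.csInf_eq ⟨⟨hξ, le_rfl⟩, fun ξ hξ' => hξ'.2⟩
  -- Some accumulation point `b` has rank `η`; a point of `rankPts` above it would have rank in `Ξ`
  -- strictly between `η` and `r α`.
  have h1 : ¬ IsLimitPt (rankPts C r Ξ α) α := fun h => by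
    obtain ⟨b, hb, h2, h3⟩ := hr.exists_eq α hαΛ hα η hη hηl
    obtain ⟨β, ⟨hβ, h4, h5⟩, h6, -⟩ := h.2 b hb
    have h7 : r b < r β := by
      refine hr.lt β (hβ.trans hαΛ) h4.isSuccLimit b h6 ?_
      rw [hC.coh α hαΛ hα β hβ h4]
      exact h2.of_subset fun y hy hy' => ⟨hy, hy'.trans h6⟩
    exact (hηΞ _ h5 (hr.lt α hαΛ hα β hβ h4)).not_gt (h3 ▸ h7)
  unfold glue glueSet
  rw [if_neg h1, if_neg h1, hnext]
  exact ⟨fun x hx => hx.1, rfl⟩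

end Glue

/-- A coherent sequence with small members on a stationary set `G` can be modified so as to guess
at points of `G`. -/
theorem exists_guess_on_stationary {κ ρ : Cardinal.{u}} (hκ : ℵ₀ < κ) (hch : LocalCH κ)
    (hρ : ρ < κ) {C : Ordinal.{u} → Set Ordinal.{u}} (hC : CoherentClubs (succ κ).ord C)
    (hsmall : ∀ α < (succ κ).ord, IsSuccLimit α → ∀ β < α,
      #(C α ∩ Iio β : Set Ordinal.{u}) < Cardinal.lift.{u + 1} κ)
    {G : Set Ordinal.{u}} (hGs : Stationary G (succ κ).ord)
    (hG : ∀ α ∈ G, α < (succ κ).ord ∧ IsSuccLimit α ∧ α.cof ≠ κ.ord.cof)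
    (hcard : ∀ α ∈ G, #(C α) ≤ Cardinal.lift.{u + 1} ρ) :
    ∃ c S, CoherentClubs (succ κ).ord c ∧ CoherentSets (succ κ).ord c S ∧
      (∀ α < (succ κ).ord, IsSuccLimit α → ∀ δ, IsLimitPt (c α) δ → IsLimitPt (C α) δ) ∧
      (∀ α < (succ κ).ord, IsSuccLimit α → ∀ β < α,
        #(c α ∩ Iio β : Set Ordinal.{u}) < Cardinal.lift.{u + 1} κ) ∧
      ∀ D A, Club D (succ κ).ord → ∃ α ∈ G, c α ⊆ D ∧ S α = A ∩ Iio α := by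
  have hreg := (isRegular_succ hκ.le).cof_ord
  obtain ⟨D, hD, hguess⟩ := exists_dropSeq_guess hκ hρ (hreg.symm ▸ lt_succ κ) hGs hcard
    fun α hα => (hC.club α (hG α hα).1 (hG α hα).2.1).lt
  obtain ⟨c, S, hc, hS, hsub, h⟩ := exists_thin_guess hκ hch hρ (hC.dropSeq hD) hG
    (fun α hα => (mk_dropSeq_le α).trans (hcard α hα)) hguess
  refine ⟨c, S, hc, hS, fun α hαΛ hα δ hδ => isLimitPt_of_dropSeq (hδ.mono (hsub α hαΛ hα)),
    fun α hαΛ hα β hβ => ?_, h⟩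
  exact (mk_le_mk_of_subset (inter_subset_inter_left _ (hsub α hαΛ hα))).trans_lt
    (mk_dropSeq_inter_Iio_lt (hsmall α hαΛ hα) hβ)

/-! ### Choosing the cofinalities. -/

theorem cof_eq_of_cof_ord_eq {α θ : Ordinal.{u}} (h : α.cof.ord = θ) : α.cof = θ.cof := by
  rw [← h, Ordinal.cof_ord_cof]

theorem isRegular_of_mem_reg {κ : Cardinal.{u}} {θ : Ordinal.{u}} (h : θ ∈ reg κ) :
    θ.cof.IsRegular ∧ θ.cof < κ := by
  obtain ⟨h1, h2, h3⟩ := h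
  refine ⟨⟨?_, (Ordinal.cof_ord_cof θ).ge⟩, ?_⟩
  · rwa [← ord_le_ord, ord_aleph0, h2]
  · rwa [← ord_lt_ord, h2]

/-- The uncountable regular cardinals below `κ` other than the cofinality of `κ`. -/
def ureg (κ : Cardinal.{u}) : Set Ordinal.{u} :=
  {θ | θ ∈ reg κ ∧ ω < θ ∧ θ.cof ≠ κ.ord.cof}

theorem succ_ord_mem_ureg {κ μ : Cardinal.{u}} (hμ : ℵ₀ ≤ μ) (hμκ : succ μ < κ)
    (hcof : succ μ ≠ κ.ord.cof) : (succ μ).ord ∈ ureg κ := by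
  have h := (isRegular_succ hμ).cof_ord
  have hω : ω < (succ μ).ord := by
    rw [← ord_aleph0, ord_lt_ord]
    exact lt_succ_of_le hμ
  exact ⟨⟨ord_lt_ord.2 hμκ, by rw [h], hω.le⟩, hω, by rwa [h]⟩

/-- Successor cardinals are cofinal below a cardinal that is not the successor of a regular. -/
theorem exists_succ_ord_mem_ureg {κ : Cardinal.{u}}
    (h_succ : ∀ μ : Cardinal.{u}, μ.IsRegular → κ ≠ succ μ) {θ : Ordinal.{u}} (hθ : θ ∈ reg κ) :
    ∃ μ, ℵ₀ ≤ μ ∧ θ ≤ (succ μ).ord ∧ (succ μ).ord ∈ ureg κ := by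
  have key : ∀ μ : Cardinal.{u}, μ.IsRegular → μ < κ → succ μ < κ := fun μ h1 h2 =>
    (succ_le_of_lt h2).lt_of_ne (h_succ μ h1).symm
  obtain ⟨h1, h2⟩ := isRegular_of_mem_reg hθ
  have hle : θ ≤ (succ θ.cof).ord :=
    hθ.2.1.symm.le.trans (ord_le_ord.2 (le_succ _))
  have h3 := key _ h1 h2
  -- The next two successors of `θ` are both below `κ`, and at most one of them is the cofinality of
  -- `κ`.
  by_cases hc : succ θ.cof = κ.ord.cof
  · have h4 := isRegular_succ h1.aleph0_le
    refine ⟨succ θ.cof, h4.aleph0_le, hle.trans (ord_le_ord.2 (le_succ _)),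
      succ_ord_mem_ureg h4.aleph0_le (key _ h4 h3) ?_⟩
    rw [← hc]
    exact (lt_succ _).ne'
  · exact ⟨θ.cof, h1.aleph0_le, hle, succ_ord_mem_ureg h1.aleph0_le h3 hc⟩

/-- The elements of `ureg κ` whose image under `ξ` is not a limit of the other images. -/
def isolatedReg (κ : Cardinal.{u}) (ξ : Ordinal.{u} → Ordinal.{u}) : Set Ordinal.{u} :=
  {θ | θ ∈ ureg κ ∧ ∃ η < ξ θ, ∀ θ' ∈ ureg κ, ξ θ' < ξ θ → ξ θ' ≤ η}

/-- Among the `θ ≥ μ⁺` take one with `ξ θ` minimal. Smaller images come from cardinals at most `μ`;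
there are fewer than `cof (ξ θ) = θ` of them, so they are bounded below `ξ θ`. -/
theorem isCofinalFor_isolatedReg {κ : Cardinal.{u}}
    (h_succ : ∀ μ : Cardinal.{u}, μ.IsRegular → κ ≠ succ μ) {ξ : Ordinal.{u} → Ordinal.{u}}
    (hξ : ∀ θ ∈ ureg κ, (ξ θ).cof = θ.cof) : IsCofinalFor (reg κ) (isolatedReg κ ξ) := by
  intro a ha
  obtain ⟨μ, hμ, haμ, hμreg⟩ := exists_succ_ord_mem_ureg h_succ ha
  obtain ⟨_, ⟨θ, hθ, rfl⟩, hmin⟩ := WellFounded.has_min (α := Ordinal.{u}) wellFounded_lt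
    (ξ '' {θ | θ ∈ ureg κ ∧ (succ μ).ord ≤ θ}) ⟨_, _, ⟨hμreg, le_rfl⟩, rfl⟩
  refine ⟨θ, ⟨hθ.1, sSup (ξ '' {θ' | θ' ∈ ureg κ ∧ ξ θ' < ξ θ}), ?_, fun θ' h1 h2 =>
    le_csSup ⟨ξ θ, ?_⟩ ⟨θ', ⟨h1, h2⟩, rfl⟩⟩, haμ.trans hθ.2⟩
  · refine sSup_lt_of_lt_cof (mk_image_le.trans_lt ?_) ?_
    · have hsub : {θ' | θ' ∈ ureg κ ∧ ξ θ' < ξ θ} ⊆ Iio (succ μ.ord) := fun θ' h => by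
        have hlt : θ' < (succ μ).ord := by
          by_contra! hle
          exact hmin _ ⟨θ', ⟨h.1, hle⟩, rfl⟩ h.2
        rw [mem_Iio, lt_succ_iff, ← h.1.1.2.1, ord_le_ord]
        exact (cof_le_card θ').trans (lt_succ_iff.1 (lt_ord.1 hlt))
      refine (mk_le_mk_of_subset hsub).trans_lt ?_
      rw [Cardinal.mk_Iio_ordinal, ← Ordinal.lift_cof, Cardinal.lift_lt, hξ θ hθ.1]
      have h4 : succ μ ≤ θ.cof := by
        rw [← ord_le_ord, hθ.1.1.2.1]
        exact hθ.2
      refine lt_of_lt_of_le (lt_ord.1 ?_) h4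
      exact (isSuccLimit_ord (hμ.trans (le_succ μ))).succ_lt (ord_lt_ord.2 (lt_succ μ))
    · rintro _ ⟨θ', h, rfl⟩
      exact h.2
  · rintro _ ⟨θ', h, rfl⟩
    exact h.2.le

/-- Only limit ranks are sure to be realised by accumulation points, so a bound `η` below `ξ` has to
be raised to a limit. -/
theorem exists_isSuccLimit_between {η ξ : Ordinal.{u}} (hξ : ℵ₀ < ξ.cof) (hη : η < ξ) :
    ∃ ε < ξ, η < ε ∧ IsSuccLimit ε := by
  have hl := isSuccLimit_of_uncountable_cof hξ
  obtain ⟨ε, h1, h2, h3⟩ := exists_closure_point hξ (g := succ) (fun β hβ => hl.succ_lt hβ)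
    (fun β _ => lt_succ β) hη
  refine ⟨ε, h1, h2, IsLimitPt.isSuccLimit (A := univ) ⟨(bot_le.trans_lt h2).ne', fun γ hγ => ?_⟩⟩
  obtain ⟨x, hx, h4, -⟩ := h3 γ hγ
  exact ⟨x, mem_univ x, h4, hx⟩

/-! ### Assembling the sequence. -/

/-- The square with built-in diamond, guessing at the cofinalities in a set `isolatedReg κ ξ`. -/
theorem exists_squareDiamond {κ : Cardinal.{u}} (hκ : ℵ₀ < κ) (hsq : Square κ) (hch : LocalCH κ) :
    ∃ ξ : Ordinal.{u} → Ordinal.{u}, (∀ θ ∈ ureg κ, (ξ θ).cof = θ.cof) ∧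
      SquareDiamond κ (isolatedReg κ ξ) := by
  obtain ⟨C, hC⟩ := hsq
  obtain ⟨r, hr, hrκ⟩ := hC.exists_isRank
  have hcc := hC.coherentClubs
  have hreg := (isRegular_succ hκ.le).cof_ord
  have hΛ : κ < (succ κ).ord.cof := hreg.symm ▸ lt_succ κ
  have hΛ' := hκ.trans hΛ
  have hΛlim := isSuccLimit_of_uncountable_cof hΛ'
  have hlim : ∀ θ ∈ ureg κ, ∀ α : Ordinal.{u}, α.cof = θ.cof → ℵ₀ < α.cof := fun θ hθ α h => by
    rw [h, ← ord_lt_ord, ord_aleph0, hθ.1.2.1]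
    exact hθ.2.1
  have hsmall : ∀ α < (succ κ).ord, IsSuccLimit α → ∀ β < α,
      #(C α ∩ Iio β : Set Ordinal.{u}) < Cardinal.lift.{u + 1} κ := fun α hαΛ hα β hβ => by
    obtain ⟨x, hx, h⟩ := (hcc.club α hαΛ hα).unbdd β hβ
    exact (mk_le_mk_of_subset (inter_subset_inter_right _ (Iio_subset_Iio h.le))).trans_lt
      (mk_inter_Iio_lt_of_typeLT_le (hC.otp_le α hαΛ hα) hx)
  have hfib : ∀ θ ∈ ureg κ, ∃ ξ < κ.ord,
      Stationary {α | α ∈ {α | α < (succ κ).ord ∧ α.cof.ord = θ} ∧ r α = ξ} (succ κ).ord := by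
    intro θ hθ
    refine (stationary_cof (by rw [hreg]) (hθ.1.1.trans (ord_lt_ord.2 (lt_succ κ))) hθ.1.2.1
      hθ.1.2.2).exists_fiber hΛ' (by rwa [card_ord]) ?_
    rintro α ⟨hαΛ, hα⟩
    have hcof := cof_eq_of_cof_ord_eq hα
    have hαl := isSuccLimit_of_uncountable_cof (hlim θ hθ α hcof)
    -- Rank `κ` would give `α` the cofinality of `κ`, which `ureg` excludes.
    refine (hrκ α hαΛ hαl).lt_of_ne fun h => hθ.2.2 ?_
    rw [← hcof, ← hr.cof_eq α hαΛ hαl, h]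
  choose! ξ hξκ hξ using hfib
  have hξcof : ∀ θ ∈ ureg κ, (ξ θ).cof = θ.cof := fun θ hθ => by
    obtain ⟨α, ⟨⟨hαΛ, hα⟩, h⟩, -⟩ := hξ θ hθ _ (Club.univ hΛlim)
    have hcof := cof_eq_of_cof_ord_eq hα
    rw [← h, hr.cof_eq α hαΛ (isSuccLimit_of_uncountable_cof (hlim θ hθ α hcof)), hcof]
  have hfam : ∀ x, ∃ c S, CoherentClubs (succ κ).ord c ∧ CoherentSets (succ κ).ord c S ∧
      (∀ α < (succ κ).ord, IsSuccLimit α → ∀ δ, IsLimitPt (c α) δ → IsLimitPt (C α) δ) ∧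
      (∀ α < (succ κ).ord, IsSuccLimit α → ∀ β < α,
        #(c α ∩ Iio β : Set Ordinal.{u}) < Cardinal.lift.{u + 1} κ) ∧
      (x ∈ ξ '' ureg κ → ∀ D A, Club D (succ κ).ord →
        ∃ α < (succ κ).ord, IsSuccLimit α ∧ r α = x ∧ c α ⊆ D ∧ S α = A ∩ Iio α) := by
    intro x
    by_cases hx : x ∈ ξ '' ureg κ
    · obtain ⟨θ, hθ, rfl⟩ := hx
      have hGl : ∀ α ∈ {α | α ∈ {α | α < (succ κ).ord ∧ α.cof.ord = θ} ∧ r α = ξ θ},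
          α < (succ κ).ord ∧ IsSuccLimit α ∧ α.cof ≠ κ.ord.cof := by
        rintro α ⟨⟨hαΛ, hα⟩, -⟩
        have hcof := cof_eq_of_cof_ord_eq hα
        exact ⟨hαΛ, isSuccLimit_of_uncountable_cof (hlim θ hθ α hcof), hcof ▸ hθ.2.2⟩
      obtain ⟨c, S, h1, h2, h3, h4, h5⟩ := exists_guess_on_stationary hκ hch
        (lt_ord.1 (hξκ θ hθ)) hcc hsmall (hξ θ hθ) hGl
        fun α hα => by rw [hr.mk_eq α (hGl α hα).1 (hGl α hα).2.1, hα.2]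
      refine ⟨c, S, h1, h2, h3, h4, fun _ D A hD => ?_⟩
      obtain ⟨α, hα, h6, h7⟩ := h5 D A hD
      exact ⟨α, (hGl α hα).1, (hGl α hα).2.1, hα.2, h6, h7⟩
    -- Every index needs a coherent sequence, since `nextRank` takes the default value `0` above all
    -- chosen ranks.
    · exact ⟨C, fun _ => ∅, hcc, fun _ _ _ _ _ _ => by simp, fun _ _ _ _ h => h, hsmall,
        fun h => (hx h).elim⟩
  choose c S hc hS hcC hcsmall hguess using hfam
  have hΞ : ∀ x ∈ ξ '' isolatedReg κ ξ, IsSuccLimit x := by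
    rintro _ ⟨θ, hθ, rfl⟩
    exact isSuccLimit_of_uncountable_cof (hlim θ hθ.1 _ (hξcof θ hθ.1))
  have hclub : ∀ α < (succ κ).ord, IsSuccLimit α →
      Club (glue C r (ξ '' isolatedReg κ ξ) c α) α := fun α hαΛ hα => glue_club hαΛ hα hc
  have hcoh : ∀ α < (succ κ).ord, IsSuccLimit α → ∀ β ∈ acc (glue C r (ξ '' isolatedReg κ ξ) c α),
      glue C r (ξ '' isolatedReg κ ξ) c β = glue C r (ξ '' isolatedReg κ ξ) c α ∩ Iio β ∧
      glueSet C r (ξ '' isolatedReg κ ξ) S β = glueSet C r (ξ '' isolatedReg κ ξ) S α ∩ Iio β := by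
    intro α hαΛ hα β hβ
    rw [mem_acc_iff] at hβ
    exact glue_coherent hcc hr hΞ hαΛ hα hc hS (fun ξ => hcC ξ α hαΛ hα)
      ((hclub α hαΛ hα).lt β hβ.1) hβ.2
  refine ⟨ξ, hξcof, glue C r (ξ '' isolatedReg κ ξ) c, glueSet C r (ξ '' isolatedReg κ ξ) S,
    ⟨fun α hαΛ hα => (isClubIn_iff hα).2 (hclub α hαΛ hα), fun α hαΛ hα => ?_,
      fun α hαΛ hα β hβ => (hcoh α hαΛ hα β hβ).1⟩,
    fun α hαΛ hα β hβ => (hcoh α hαΛ hα β hβ).2, fun D hD A _ θ hθ _ => ?_⟩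
  · exact typeLT_le_of_mk_inter_Iio_lt fun x hx => mk_glue_inter_Iio_lt hcc hαΛ hα
      (hsmall α hαΛ hα) (fun ξ => hcsmall ξ α hαΛ hα) ((hclub α hαΛ hα).lt x hx)
  · obtain ⟨α, hαΛ, hα, hrα, h1, h2⟩ :=
      hguess (ξ θ) ⟨θ, hθ.1, rfl⟩ D A ((isClubIn_iff hΛlim).1 hD)
    have hcof : α.cof = θ.cof := by rw [← hr.cof_eq α hαΛ hα, hrα, hξcof θ hθ.1]
    obtain ⟨η, hη, hη'⟩ := hθ.2
    obtain ⟨ε, h3, h4, h5⟩ := exists_isSuccLimit_between (hlim θ hθ.1 _ (hξcof θ hθ.1)) hη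
    obtain ⟨h6, h7⟩ := glue_subset (c := c) (S := S) (Ξ := ξ '' isolatedReg κ ξ) hcc hr hαΛ hα
      (hrα ▸ ⟨θ, hθ, rfl⟩) (hrα.symm ▸ h3) h5 (by
        rintro _ ⟨θ', hθ', rfl⟩ hlt
        exact (hη' θ' hθ'.1 (hrα ▸ hlt)).trans_lt h4)
    rw [hrα] at h6 h7
    exact ⟨α, hαΛ, h6.trans h1, h7.trans h2, by rw [hcof, hθ.1.1.2.1],
      (hclub α hαΛ hα).isLUB_acc (hlim θ hθ.1 α hcof)⟩

end OstSquare

theorem theorem2p1 (κ : Cardinal.{u}) (h_unc : ℵ₀ < κ)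
    (h_succ : ∀ μ : Cardinal.{u}, μ.IsRegular → κ ≠ Order.succ μ)
    (h_sq : OstSquare.Square κ) (h_ch : OstSquare.LocalCH κ) :
    ∃ Γ : Set Ordinal.{u}, Γ ⊆ OstSquare.reg κ ∧
      IsCofinalFor (OstSquare.reg κ) Γ ∧ OstSquare.SquareDiamond κ Γ := by
  obtain ⟨ξ, hξ, h⟩ := OstSquare.exists_squareDiamond h_unc h_sq h_ch
  exact ⟨_, fun θ hθ => hθ.1.1, OstSquare.isCofinalFor_isolatedReg h_succ hξ, h⟩
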